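/- Let $N\ge 1$, let $\mathbb{B}_N$ and $\mathbb{S}_N$ be the open unit ball and the unit sphere of $\mathbb{C}^N$ for the Euclidean norm $|\cdot|$, and let $\sigma_N$ be the normalized rotation-invariant measure on $\mathbb{S}_N$. An Orlicz function is a strictly convex function $\psi:[0,\infty)\to[0,\infty)$ with $\psi(0)=0$, continuous at $0$, such that $\psi(x)/x\to\infty$ as $x\to\infty$; then $\psi$ is a bijection of $[0,\infty)$ with inverse $\psi^{-1}$. The Hardy–Orlicz space $H^\psi(\mathbb{B}_N)$ is the space of holomorphic $f:\mathbb{B}_N\to\mathbb{C}$ with $$\|f\|_{H^\psi}=\sup_{0<r<1}\ \inf\Big\{C>0:\ \int_{\mathbb{S}_N}\psi\Big(\frac{|f(r\zeta)|}{C}\Big)\,d\sigma_N(\zeta)\le 1\Big\}<\infty,$$ normed by $\|\cdot\|_{H^\psi}$. **Proposition 3.14.** Let $\phi:\mathbb{B}_N\to\mathbb{B}_N$ be holomorphic and let $\psi$ be an Orlicz function. If the composition operator $C_\phi f=f\circ\phi$ maps $H^\psi(\mathbb{B}_N)$ into itself and is compact on $H^\psi(\mathbb{B}_N)$, then $$\lim_{|z|\to1}\frac{\psi^{-1}\big(1/(1-|\phi(z)|)^{N}\big)}{\psi^{-1}\big(1/(1-|z|)^{N}\big)}=0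 .$$ -/

import Mathlib

open MeasureTheory Filter Topology
open scoped ENNReal

namespace HardyOrliczBall

/-- An Orlicz function: a strictly convex function `ψ : [0, ∞) → [0, ∞)` with `ψ 0 = 0`, continuous
at `0`, and such that `ψ x / x → ∞` as `x → ∞`. It is stored as a function `ℝ → ℝ`; only its values
on `[0, ∞)` are ever used. -/
structure OrliczFunction where
  toFun : ℝ → ℝ
  strictConvexOn : StrictConvexOn ℝ (Set.Ici 0) toFun
  nonneg : ∀ x, 0 ≤ x → 0 ≤ toFun x
  map_zero : toFun 0 = 0
  continuousWithinAt_zero : ContinuousWithinAt toFun (Set.Ici 0) 0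
  tendsto_div : Tendsto (fun x => toFun x / x) atTop atTop

namespace OrliczFunction

variable (ψ : OrliczFunction)

/-- The inverse `ψ⁻¹ : [0, ∞) → [0, ∞)` of the bijection `ψ : [0, ∞) → [0, ∞)`. -/
noncomputable def inv (y : ℝ) : ℝ := Function.invFunOn ψ.toFun (Set.Ici 0) y

theorem strictMonoOn : StrictMonoOn ψ.toFun (Set.Ici 0) := by
  have key : ∀ x y : ℝ, 0 ≤ x → x < y → ψ.toFun x < ψ.toFun y ∨ ψ.toFun y = 0 := by
    intro x y hx hxy
    have hy : 0 < y := lt_of_le_of_lt hx hxy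
    have h := ψ.strictConvexOn.convexOn.2 (Set.mem_Ici.2 le_rfl) (Set.mem_Ici.2 hy.le)
      (show 0 ≤ 1 - x / y by rw [sub_nonneg, div_le_one hy]; exact hxy.le)
      (show 0 ≤ x / y by positivity) (by ring)
    have e : (1 - x / y) • (0 : ℝ) + (x / y) • y = x := by
      simp only [smul_eq_mul]; field_simp; ring
    rw [e] at h
    simp only [smul_eq_mul, ψ.map_zero, mul_zero, zero_add] at h
    rcases (ψ.nonneg y hy.le).eq_or_lt with h0 | h0
    · exact Or.inr h0.symm
    · left
      have : x / y < 1 := (div_lt_one hy).2 hxy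
      nlinarith
  have pos : ∀ y : ℝ, 0 < y → ψ.toFun y ≠ 0 := by
    intro y hy h0
    have h := ψ.strictConvexOn.2 (Set.mem_Ici.2 le_rfl) (Set.mem_Ici.2 hy.le) hy.ne
      (show (0 : ℝ) < 1 / 2 by norm_num) (show (0 : ℝ) < 1 / 2 by norm_num) (by norm_num)
    simp only [smul_eq_mul, ψ.map_zero, mul_zero, zero_add, h0] at h
    exact absurd h (not_lt.2 (ψ.nonneg _ (by positivity)))
  intro x hx y _ hxy
  exact (key x y hx hxy).resolve_right (pos y (lt_of_le_of_lt hx hxy))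

theorem pos {x : ℝ} (hx : 0 < x) : 0 < ψ.toFun x := by
  have := ψ.strictMonoOn (Set.mem_Ici.2 le_rfl) (Set.mem_Ici.2 hx.le) hx
  rwa [ψ.map_zero] at this

theorem le_of_le {x y : ℝ} (hx : 0 ≤ x) (hxy : x ≤ y) : ψ.toFun x ≤ ψ.toFun y :=
  ψ.strictMonoOn.monotoneOn (Set.mem_Ici.2 hx) (Set.mem_Ici.2 (hx.trans hxy)) hxy

theorem surjOn : Set.SurjOn ψ.toFun (Set.Ici 0) (Set.Ici 0) := by
  have hc : ContinuousOn ψ.toFun (Set.Ici 0) := by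
    intro x hx
    rcases (Set.mem_Ici.1 hx).eq_or_lt with h | h
    · rw [← h]; exact ψ.continuousWithinAt_zero
    · have h1 := (ψ.strictConvexOn.convexOn.subset Set.Ioi_subset_Ici_self
        (convex_Ioi 0)).continuousOn isOpen_Ioi
      exact ((h1 x h).continuousAt (Ioi_mem_nhds h)).continuousWithinAt
  intro y hy
  obtain ⟨b, hb1, hb⟩ := ((ψ.tendsto_div.eventually_ge_atTop y).and
    (eventually_ge_atTop (1 : ℝ))).exists.imp fun b h => And.intro h.2 h.1
  have hb0 : 0 < b := by linarith
  have hyb : y ≤ ψ.toFun b := by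
    rw [le_div_iff₀ hb0] at hb
    nlinarith [Set.mem_Ici.1 hy]
  obtain ⟨x, hx, hxy⟩ := intermediate_value_Icc hb0.le (hc.mono Set.Icc_subset_Ici_self)
    (Set.mem_Icc.2 ⟨by rw [ψ.map_zero]; exact hy, hyb⟩)
  exact ⟨x, hx.1, hxy⟩

theorem inv_nonneg {y : ℝ} (hy : 0 ≤ y) : 0 ≤ ψ.inv y :=
  Function.invFunOn_mem (ψ.surjOn hy)

theorem apply_inv {y : ℝ} (hy : 0 ≤ y) : ψ.toFun (ψ.inv y) = y :=
  Function.invFunOn_eq (ψ.surjOn hy)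

theorem inv_apply {x : ℝ} (hx : 0 ≤ x) : ψ.inv (ψ.toFun x) = x :=
  ψ.strictMonoOn.injOn (ψ.inv_nonneg (ψ.nonneg x hx)) hx (ψ.apply_inv (ψ.nonneg x hx))

/-- The Luxemburg norm `inf {C > 0 : ∫ ψ (|f| / C) dμ ≤ 1}`, with values in `[0, ∞]`; it is `∞` when
there is no such `C`. -/
noncomputable def luxemburgNorm {Ω : Type*} [MeasurableSpace Ω] (μ : Measure Ω) (f : Ω → ℂ) :
    ℝ≥0∞ :=
  ⨅ (C : ℝ) (_ : 0 < C) (_ : ∫⁻ ω, ENNReal.ofReal (ψ.toFun (‖f ω‖ / C)) ∂μ ≤ 1), ENNReal.ofReal C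

section Luxemburg

variable {Ω : Type*} [MeasurableSpace Ω] {μ : Measure Ω} {f g : Ω → ℂ}

theorem luxemburgNorm_le {C : ℝ} (hC : 0 < C)
    (h : ∫⁻ ω, ENNReal.ofReal (ψ.toFun (‖f ω‖ / C)) ∂μ ≤ 1) :
    ψ.luxemburgNorm μ f ≤ ENNReal.ofReal C :=
  iInf_le_of_le C (iInf_le_of_le hC (iInf_le _ h))

theorem lintegral_le_one {a : ℝ} (ha : 0 < a) (h : ψ.luxemburgNorm μ f < ENNReal.ofReal a) :
    ∫⁻ ω, ENNReal.ofReal (ψ.toFun (‖f ω‖ / a)) ∂μ ≤ 1 := by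
  simp only [luxemburgNorm, iInf_lt_iff] at h
  obtain ⟨C, hC, hi, hlt⟩ := h
  refine le_trans (lintegral_mono fun ω => ENNReal.ofReal_le_ofReal ?_) hi
  refine ψ.le_of_le (by positivity) ?_
  have := (ENNReal.ofReal_lt_ofReal_iff ha).1 hlt
  gcongr

theorem measurable_comp_norm (hf : Measurable f) (a : ℝ) (ha : 0 < a) :
    Measurable fun ω => ENNReal.ofReal (ψ.toFun (‖f ω‖ / a)) := by
  have hm : Monotone fun x : ℝ => ψ.toFun (max x 0) := fun x y h =>
    ψ.le_of_le (le_max_right _ _) (max_le_max_right _ h)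
  have h1 := (hm.measurable.comp (hf.norm.div_const a)).ennreal_ofReal
  have e : (fun ω => ENNReal.ofReal (ψ.toFun (‖f ω‖ / a))) =
      fun ω => ENNReal.ofReal (((fun x => ψ.toFun (max x 0)) ∘ fun x => ‖f x‖ / a) ω) := by
    funext ω
    simp only [Function.comp]
    rw [max_eq_left (by positivity)]
  rw [e]
  exact h1

theorem luxemburgNorm_zero : ψ.luxemburgNorm μ 0 = 0 := by
  refine le_antisymm (ENNReal.le_of_forall_pos_le_add fun ε hε _ => ?_) bot_le
  rw [zero_add, ← ENNReal.ofReal_coe_nnreal]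
  exact ψ.luxemburgNorm_le (by exact_mod_cast hε) (by simp [ψ.map_zero])

theorem luxemburgNorm_add_le (hf : Measurable f) :
    ψ.luxemburgNorm μ (f + g) ≤ ψ.luxemburgNorm μ f + ψ.luxemburgNorm μ g := by
  have conv : ∀ a b : ℝ, 0 < a → 0 < b → ψ.luxemburgNorm μ f < ENNReal.ofReal a →
      ψ.luxemburgNorm μ g < ENNReal.ofReal b →
      ψ.luxemburgNorm μ (f + g) ≤ ENNReal.ofReal a + ENNReal.ofReal b := by
    intro a b ha hb hfa hgb
    have hab : 0 < a + b := by positivity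
    rw [← ENNReal.ofReal_add ha.le hb.le]
    refine ψ.luxemburgNorm_le hab ?_
    have hpt : ∀ ω, ENNReal.ofReal (ψ.toFun (‖(f + g) ω‖ / (a + b))) ≤
        ENNReal.ofReal (a / (a + b)) * ENNReal.ofReal (ψ.toFun (‖f ω‖ / a)) +
        ENNReal.ofReal (b / (a + b)) * ENNReal.ofReal (ψ.toFun (‖g ω‖ / b)) := by
      intro ω
      have hA := ψ.nonneg (‖f ω‖ / a) (by positivity)
      have hB := ψ.nonneg (‖g ω‖ / b) (by positivity)
      rw [← ENNReal.ofReal_mul (by positivity), ← ENNReal.ofReal_mul (by positivity),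
        ← ENNReal.ofReal_add (by positivity) (by positivity)]
      refine ENNReal.ofReal_le_ofReal ?_
      have h1 : ‖(f + g) ω‖ / (a + b) ≤
          (a / (a + b)) * (‖f ω‖ / a) + (b / (a + b)) * (‖g ω‖ / b) := by
        have e : (a / (a + b)) * (‖f ω‖ / a) + (b / (a + b)) * (‖g ω‖ / b)
            = (‖f ω‖ + ‖g ω‖) / (a + b) := by field_simp
        rw [e]
        gcongr
        exact norm_add_le _ _
      refine (ψ.le_of_le (by positivity) h1).trans ?_
      exact ψ.strictConvexOn.convexOn.2 (Set.mem_Ici.2 (by positivity))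
        (Set.mem_Ici.2 (by positivity)) (by positivity) (by positivity) (by field_simp)
    refine (lintegral_mono hpt).trans ?_
    rw [lintegral_add_left ((ψ.measurable_comp_norm hf a ha).const_mul _),
      lintegral_const_mul' _ _ ENNReal.ofReal_ne_top,
      lintegral_const_mul' _ _ ENNReal.ofReal_ne_top]
    calc _ ≤ ENNReal.ofReal (a / (a + b)) * 1 + ENNReal.ofReal (b / (a + b)) * 1 := by
          gcongr
          · exact ψ.lintegral_le_one ha hfa
          · exact ψ.lintegral_le_one hb hgb
      _ = 1 := by
          rw [mul_one, mul_one, ← ENNReal.ofReal_add (by positivity) (by positivity), ← add_div,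
            div_self hab.ne', ENNReal.ofReal_one]
  by_cases hfT : ψ.luxemburgNorm μ f = ∞
  · simp [hfT]
  by_cases hgT : ψ.luxemburgNorm μ g = ∞
  · simp [hgT]
  refine ENNReal.le_of_forall_pos_le_add fun ε hε _ => ?_
  have hε' : (0 : ℝ) < ε / 2 := by positivity
  have h := conv ((ψ.luxemburgNorm μ f).toReal + ε / 2) ((ψ.luxemburgNorm μ g).toReal + ε / 2)
    (by positivity) (by positivity) (by
      rw [ENNReal.ofReal_add ENNReal.toReal_nonneg hε'.le, ENNReal.ofReal_toReal hfT]
      exact ENNReal.lt_add_right hfT (by simpa using hε)) (by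
      rw [ENNReal.ofReal_add ENNReal.toReal_nonneg hε'.le, ENNReal.ofReal_toReal hgT]
      exact ENNReal.lt_add_right hgT (by simpa using hε))
  refine h.trans (le_of_eq ?_)
  rw [ENNReal.ofReal_add ENNReal.toReal_nonneg hε'.le, ENNReal.ofReal_toReal hfT,
    ENNReal.ofReal_add ENNReal.toReal_nonneg hε'.le, ENNReal.ofReal_toReal hgT,
    add_add_add_comm, ← ENNReal.ofReal_add hε'.le hε'.le, add_halves, ENNReal.ofReal_coe_nnreal]

theorem luxemburgNorm_smul_le (c : ℂ) :
    ψ.luxemburgNorm μ (c • f) ≤ ENNReal.ofReal ‖c‖ * ψ.luxemburgNorm μ f := by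
  rcases eq_or_ne c 0 with rfl | hc
  · rw [zero_smul, ψ.luxemburgNorm_zero]; exact bot_le
  have hc' : 0 < ‖c‖ := norm_pos_iff.2 hc
  conv_rhs => rw [luxemburgNorm]
  have h0 : ENNReal.ofReal ‖c‖ ≠ 0 := by simpa using hc
  simp only [ENNReal.mul_iInf_of_ne h0 ENNReal.ofReal_ne_top]
  refine le_iInf fun C => le_iInf fun hC => le_iInf fun h => ?_
  rw [← ENNReal.ofReal_mul hc'.le]
  refine ψ.luxemburgNorm_le (by positivity) (le_of_eq_of_le (lintegral_congr fun ω => ?_) h)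
  rw [Pi.smul_apply, norm_smul, mul_div_mul_left _ _ hc'.ne']

theorem ae_eq_zero (hf : Measurable f) (h : ψ.luxemburgNorm μ f = 0) : f =ᵐ[μ] 0 := by
  have key : ∀ C : ℝ, 0 < C → C ≤ 1 →
      ∫⁻ ω, ENNReal.ofReal (ψ.toFun (‖f ω‖ / 1)) ∂μ ≤ ENNReal.ofReal C := by
    intro C hC hC1
    have h1 := ψ.lintegral_le_one (μ := μ) (f := f) hC (by rw [h]; simpa using hC)
    calc _ ≤ ∫⁻ ω, ENNReal.ofReal C * ENNReal.ofReal (ψ.toFun (‖f ω‖ / C)) ∂μ := by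
          refine lintegral_mono fun ω => ?_
          rw [← ENNReal.ofReal_mul hC.le]
          refine ENNReal.ofReal_le_ofReal ?_
          have h2 := ψ.strictConvexOn.convexOn.2 (Set.mem_Ici.2 le_rfl)
            (Set.mem_Ici.2 (show 0 ≤ ‖f ω‖ / C by positivity))
            (show 0 ≤ 1 - C by linarith) hC.le (by ring)
          simp only [smul_eq_mul, ψ.map_zero, mul_zero, zero_add] at h2
          rw [mul_div_cancel₀ _ hC.ne'] at h2
          rwa [div_one]
      _ ≤ ENNReal.ofReal C * 1 := by
          rw [lintegral_const_mul' _ _ ENNReal.ofReal_ne_top]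
          gcongr
      _ = _ := mul_one _
  have hz : ∫⁻ ω, ENNReal.ofReal (ψ.toFun (‖f ω‖ / 1)) ∂μ = 0 := by
    refine le_antisymm (ENNReal.le_of_forall_pos_le_add fun ε hε _ => ?_) bot_le
    rw [zero_add]
    refine (key (min ε 1) (by positivity) (min_le_right _ _)).trans ?_
    rw [← ENNReal.ofReal_coe_nnreal]
    exact ENNReal.ofReal_le_ofReal (min_le_left _ _)
  rw [lintegral_eq_zero_iff (ψ.measurable_comp_norm hf 1 one_pos)] at hz
  filter_upwards [hz] with ω hω
  by_contra hne
  have : 0 < ‖f ω‖ / 1 := by rw [div_one]; exact norm_pos_iff.2 hne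
  have h3 := ψ.pos this
  simp only [Pi.zero_apply, ENNReal.ofReal_eq_zero] at hω
  linarith

end Luxemburg

end OrliczFunction

/-- The open unit ball `𝔹_N` of `ℂ^N` with its Euclidean norm. -/
abbrev UnitBall (N : ℕ) : Type := Metric.ball (0 : EuclideanSpace ℂ (Fin N)) 1

/-- The unit sphere `𝕊_N` of `ℂ^N`. -/
abbrev UnitSphere (N : ℕ) : Type := Metric.sphere (0 : EuclideanSpace ℂ (Fin N)) 1

/-- The normalized rotation-invariant measure `σ_N` on the unit sphere. -/
noncomputable def sphereMeasure (N : ℕ) : Measure (UnitSphere N) :=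
  ((volume : Measure (EuclideanSpace ℂ (Fin N))).toSphere Set.univ)⁻¹ •
    (volume : Measure (EuclideanSpace ℂ (Fin N))).toSphere

/-- Holomorphy of a map defined on the unit ball only. -/
def IsHolomorphic {N : ℕ} {F : Type*} [NormedAddCommGroup F] [NormedSpace ℂ F]
    (f : UnitBall N → F) : Prop :=
  ∃ g : EuclideanSpace ℂ (Fin N) → F,
    DifferentiableOn ℂ g (Metric.ball 0 1) ∧ ∀ z : UnitBall N, g z = f z

/-- The point `r ζ` of the unit ball, for `0 < r < 1` and `ζ` in the unit sphere. -/
noncomputable def dilate {N : ℕ} (r : Set.Ioo (0 : ℝ) 1) (ζ : UnitSphere N) : UnitBall N :=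
  ⟨(r : ℝ) • (ζ : EuclideanSpace ℂ (Fin N)), by
    have h1 : ‖(ζ : EuclideanSpace ℂ (Fin N))‖ = 1 := by simp
    rw [mem_ball_zero_iff, norm_smul, h1, mul_one, Real.norm_of_nonneg r.2.1.le]
    exact r.2.2⟩

/-- `‖f‖_{H^ψ} = sup_{0 < r < 1} ‖f_r‖_ψ`, where `f_r(ζ) = f(r ζ)`, with values in `[0, ∞]`. -/
noncomputable def hardyOrliczNorm {N : ℕ} (ψ : OrliczFunction) (f : UnitBall N → ℂ) : ℝ≥0∞ :=
  ⨆ r : Set.Ioo (0 : ℝ) 1, ψ.luxemburgNorm (sphereMeasure N) fun ζ => f (dilate r ζ)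

theorem IsHolomorphic.continuous {N : ℕ} {f : UnitBall N → ℂ} (hf : IsHolomorphic f) :
    Continuous f := by
  obtain ⟨g, hg, he⟩ := hf
  exact (continuousOn_iff_continuous_domRestrict.1 hg.continuousOn).congr he

theorem continuous_dilate {N : ℕ} (r : Set.Ioo (0 : ℝ) 1) :
    Continuous (dilate r : UnitSphere N → UnitBall N) :=
  Continuous.subtype_mk (continuous_subtype_val.const_smul (r : ℝ)) _

theorem hardyOrliczNorm_zero {N : ℕ} (ψ : OrliczFunction) :
    hardyOrliczNorm ψ (0 : UnitBall N → ℂ) = 0 := by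
  simp only [hardyOrliczNorm, ENNReal.iSup_eq_zero]
  exact fun r => ψ.luxemburgNorm_zero

theorem hardyOrliczNorm_add_le {N : ℕ} (ψ : OrliczFunction) {f : UnitBall N → ℂ}
    (g : UnitBall N → ℂ) (hf : IsHolomorphic f) :
    hardyOrliczNorm ψ (f + g) ≤ hardyOrliczNorm ψ f + hardyOrliczNorm ψ g :=
  iSup_le fun r => (ψ.luxemburgNorm_add_le
    (hf.continuous.comp (continuous_dilate r)).measurable).trans
      (add_le_add (le_iSup (fun r => ψ.luxemburgNorm (sphereMeasure N) fun ζ => f (dilate r ζ)) r)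
        (le_iSup (fun r => ψ.luxemburgNorm (sphereMeasure N) fun ζ => g (dilate r ζ)) r))

theorem hardyOrliczNorm_smul_le {N : ℕ} (ψ : OrliczFunction) (c : ℂ) (f : UnitBall N → ℂ) :
    hardyOrliczNorm ψ (c • f) ≤ ENNReal.ofReal ‖c‖ * hardyOrliczNorm ψ f :=
  iSup_le fun r => (ψ.luxemburgNorm_smul_le c).trans
    (mul_le_mul' le_rfl (le_iSup
      (fun r => ψ.luxemburgNorm (sphereMeasure N) fun ζ => f (dilate r ζ)) r))

theorem eq_zero_of_hardyOrliczNorm {N : ℕ} [NeZero N] (ψ : OrliczFunction) {f : UnitBall N → ℂ}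
    (hf : IsHolomorphic f) (h : hardyOrliczNorm ψ f = 0) : f = 0 := by
  have hr : ∀ (r : Set.Ioo (0 : ℝ) 1) (ζ : UnitSphere N), f (dilate r ζ) = 0 := by
    intro r
    have hc := hf.continuous.comp (continuous_dilate (N := N) r)
    have h0 : ψ.luxemburgNorm (sphereMeasure N) (fun ζ => f (dilate r ζ)) = 0 :=
      (ENNReal.iSup_eq_zero.1 h) r
    have hae := ψ.ae_eq_zero hc.measurable h0
    have hae' : (f ∘ dilate r) =ᵐ[(volume : Measure (EuclideanSpace ℂ (Fin N))).toSphere] 0 := by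
      rw [sphereMeasure] at hae
      exact (Measure.ae_ennreal_smul_measure_iff
        (ENNReal.inv_ne_zero.2 (measure_ne_top
          (volume : Measure (EuclideanSpace ℂ (Fin N))).toSphere _))).1 hae
    exact congrFun (Continuous.ae_eq_iff_eq _ hc continuous_zero |>.1 hae')
  have hne : ∀ z : UnitBall N, (z : EuclideanSpace ℂ (Fin N)) ≠ 0 → f z = 0 := by
    intro z hz
    have hz' : 0 < ‖(z : EuclideanSpace ℂ (Fin N))‖ := norm_pos_iff.2 hz
    have := hr ⟨‖(z : EuclideanSpace ℂ (Fin N))‖, hz', mem_ball_zero_iff.1 z.2⟩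
      ⟨(‖(z : EuclideanSpace ℂ (Fin N))‖⁻¹ : ℝ) • (z : EuclideanSpace ℂ (Fin N)), by
        rw [mem_sphere_zero_iff_norm, norm_smul, norm_inv, norm_norm, inv_mul_cancel₀ hz'.ne']⟩
    rw [← this]
    congr 1
    ext1
    simp [dilate, smul_smul, hz'.ne']
  funext z
  by_cases hz : (z : EuclideanSpace ℂ (Fin N)) = 0
  · obtain ⟨g, hg, he⟩ := hf
    have hcont : ContinuousAt g 0 :=
      (hg.continuousOn 0 (by simp)).continuousAt (Metric.ball_mem_nhds _ one_pos)
    have h1 : Tendsto g (𝓝[≠] 0) (𝓝 (g 0)) := hcont.tendsto.mono_left nhdsWithin_le_nhds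
    have h2 : Tendsto g (𝓝[≠] 0) (𝓝 0) := by
      refine tendsto_const_nhds.congr' ?_
      filter_upwards [self_mem_nhdsWithin,
        nhdsWithin_le_nhds (Metric.ball_mem_nhds (0 : EuclideanSpace ℂ (Fin N)) one_pos)]
        with w hw hwb
      rw [he ⟨w, hwb⟩, hne ⟨w, hwb⟩ hw]
    rw [← he, hz]
    exact tendsto_nhds_unique h1 h2
  · exact hne z hz

/-- The vector space of holomorphic functions `f : 𝔹_N → ℂ` with `‖f‖_{H^ψ} < ∞`. -/
def hardyOrliczSubmodule (N : ℕ) (ψ : OrliczFunction) : Submodule ℂ (UnitBall N → ℂ) where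
  carrier := {f | IsHolomorphic f ∧ hardyOrliczNorm ψ f < ∞}
  add_mem' := by
    rintro f g ⟨hf, hf'⟩ ⟨hg, hg'⟩
    refine ⟨?_, (hardyOrliczNorm_add_le ψ g hf).trans_lt (ENNReal.add_lt_top.2 ⟨hf', hg'⟩)⟩
    obtain ⟨F, hF, hFe⟩ := hf
    obtain ⟨G, hG, hGe⟩ := hg
    exact ⟨F + G, hF.add hG, fun z => by simp [hFe, hGe]⟩
  zero_mem' := ⟨⟨0, differentiableOn_const 0, fun _ => rfl⟩, by
    rw [hardyOrliczNorm_zero]; exact ENNReal.zero_lt_top⟩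
  smul_mem' := by
    rintro c f ⟨hf, hf'⟩
    refine ⟨?_, (hardyOrliczNorm_smul_le ψ c f).trans_lt
      (ENNReal.mul_lt_top ENNReal.ofReal_lt_top hf')⟩
    obtain ⟨F, hF, hFe⟩ := hf
    exact ⟨c • F, hF.const_smul c, fun z => by simp [hFe]⟩

/-- The Hardy-Orlicz space `H^ψ(𝔹_N)`. This is a new type, so that it carries the topology of its
norm and not the topology of pointwise convergence that the submodule inherits. -/
def HardyOrlicz (N : ℕ) (ψ : OrliczFunction) : Type := hardyOrliczSubmodule N ψ

namespace HardyOrlicz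

variable {N : ℕ} {ψ : OrliczFunction}

instance instAddCommGroup : AddCommGroup (HardyOrlicz N ψ) :=
  inferInstanceAs (AddCommGroup (hardyOrliczSubmodule N ψ))

instance instModule : Module ℂ (HardyOrlicz N ψ) :=
  inferInstanceAs (Module ℂ (hardyOrliczSubmodule N ψ))

instance instFunLike : FunLike (HardyOrlicz N ψ) (UnitBall N) ℂ where
  coe f := f.1
  coe_injective := Subtype.val_injective

theorem isHolomorphic (f : HardyOrlicz N ψ) : IsHolomorphic f := f.2.1

theorem norm_lt_top (f : HardyOrlicz N ψ) : hardyOrliczNorm ψ f < ∞ := f.2.2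

noncomputable instance instNorm : Norm (HardyOrlicz N ψ) :=
  ⟨fun f => (hardyOrliczNorm ψ f).toReal⟩

theorem core [NeZero N] : NormedSpace.Core ℂ (HardyOrlicz N ψ) where
  norm_nonneg _ := ENNReal.toReal_nonneg
  norm_smul c f := by
    have le : ∀ (c : ℂ) (f : HardyOrlicz N ψ), ‖c • f‖ ≤ ‖c‖ * ‖f‖ := by
      intro c f
      have h := ENNReal.toReal_mono
        (ENNReal.mul_ne_top ENNReal.ofReal_ne_top f.norm_lt_top.ne)
        (hardyOrliczNorm_smul_le ψ c f)
      rwa [ENNReal.toReal_mul, ENNReal.toReal_ofReal (norm_nonneg c)] at h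
    refine le_antisymm (le c f) ?_
    rcases eq_or_ne c 0 with rfl | hc
    · rw [norm_zero, zero_mul]; exact ENNReal.toReal_nonneg
    have h := le c⁻¹ (c • f)
    rw [inv_smul_smul₀ hc, norm_inv] at h
    rwa [inv_mul_eq_div, le_div_iff₀' (norm_pos_iff.2 hc)] at h
  norm_triangle f g := by
    have h := ENNReal.toReal_mono (ENNReal.add_ne_top.2 ⟨f.norm_lt_top.ne, g.norm_lt_top.ne⟩)
      (hardyOrliczNorm_add_le ψ g f.isHolomorphic)
    rwa [ENNReal.toReal_add f.norm_lt_top.ne g.norm_lt_top.ne] at h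
  norm_eq_zero_iff f := by
    constructor
    · intro h
      have h0 : hardyOrliczNorm ψ f = 0 :=
        ((ENNReal.toReal_eq_zero_iff _).1 h).resolve_right f.norm_lt_top.ne
      exact DFunLike.coe_injective (eq_zero_of_hardyOrliczNorm ψ f.isHolomorphic h0)
    · rintro rfl
      have : hardyOrliczNorm ψ (0 : HardyOrlicz N ψ) = 0 := hardyOrliczNorm_zero ψ
      exact (ENNReal.toReal_eq_zero_iff _).2 (Or.inl this)

noncomputable instance instNormedAddCommGroup [NeZero N] : NormedAddCommGroup (HardyOrlicz N ψ) :=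
  NormedAddCommGroup.ofCore core

noncomputable instance instNormedSpace [NeZero N] : NormedSpace ℂ (HardyOrlicz N ψ) :=
  NormedSpace.ofCore core

end HardyOrlicz

/-- The composition operator `C_ϕ f = f ∘ ϕ` maps `H^ψ(𝔹_N)` into itself, and it is a compact
operator on this space. -/
def IsCompactCompositionOperator {N : ℕ} [NeZero N] (ψ : OrliczFunction)
    (ϕ : UnitBall N → UnitBall N) : Prop :=
  ∃ T : HardyOrlicz N ψ →ₗ[ℂ] HardyOrlicz N ψ,
    (∀ (f : HardyOrlicz N ψ) (z : UnitBall N), T f z = f (ϕ z)) ∧ IsCompactOperator T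

end HardyOrliczBall

/-! Write `M(x) = ψ⁻¹(1 / (1 - |x|) ^ N)` and test compactness on `f_a(z) = M(a) ((1 - |a|) / (1 -
⟨z, a⟩)) ^ (2N + 1)`. These are bounded in `H^ψ` (`exists_testFunction`) and tend to `0` pointwise
as `|a| → 1` (`tendsto_testFunction_zero`); point evaluation at `z` has norm at most a constant
times `M(z)` (`exists_norm_apply_le`). Let `|z_k| → 1` and `a_k = ϕ(z_k)`. If `|a_k|` tends to a
limit below `1`, the numerator `M(a_k)` is bounded and `M(z_k) → ∞`. If `|a_k| → 1`, compactness
gives a norm limit of `C_ϕ f_{a_k}` along a subsequence; evaluations identify it as `0`. Since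
`f_a(a) = M(a) / (1 + |a|) ^ (2N + 1)`, evaluation at `z_k` gives `M(a_k) / M(z_k) ≤ const * ‖C_ϕ
f_{a_k}‖ → 0`.

Both uniform estimates replace spheres by solid regions, with a map scaling by `s ^ 2` radially and
by `s` tangentially (Jacobian `s ^ (2N + 2)`). For evaluations, an ellipsoid centred at `z` of
volume comparable to `d ^ (N + 1)`, `d = 1 - |z|`, lies in a shell of thickness `2d`; the sub-mean
value property gives `ψ(|f(z)| / K) ≤ C / d ^ N`. For the test functions, convexity reduces the norm
bound to an `L¹` bound of the kernel on spheres, obtained by averaging over a thin shell and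
rescaling. -/

namespace HardyOrliczBall

/-! ### Monotonicity and growth of the inverse Orlicz function -/

namespace OrliczFunction

variable (ψ : OrliczFunction)

theorem continuousOn : ContinuousOn ψ.toFun (Set.Ici 0) := by
  intro x hx
  rcases (Set.mem_Ici.1 hx).eq_or_lt with h | h
  · rw [← h]; exact ψ.continuousWithinAt_zero
  · have h1 := (ψ.strictConvexOn.convexOn.subset Set.Ioi_subset_Ici_self
      (convex_Ioi 0)).continuousOn isOpen_Ioi
    exact ((h1 x h).continuousAt (Ioi_mem_nhds h)).continuousWithinAt

theorem le_inv {x y : ℝ} (hx : 0 ≤ x) (h : ψ.toFun x ≤ y) : x ≤ ψ.inv y := by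
  have hy : 0 ≤ y := (ψ.nonneg x hx).trans h
  rw [← ψ.apply_inv hy] at h
  exact (ψ.strictMonoOn.le_iff_le hx (ψ.inv_nonneg hy)).1 h

theorem inv_le {x y : ℝ} (hx : 0 ≤ x) (hy : 0 ≤ y) (h : y ≤ ψ.toFun x) : ψ.inv y ≤ x := by
  rw [← ψ.apply_inv hy] at h
  exact (ψ.strictMonoOn.le_iff_le (ψ.inv_nonneg hy) hx).1 h

theorem inv_mono {x y : ℝ} (hx : 0 ≤ x) (h : x ≤ y) : ψ.inv x ≤ ψ.inv y :=
  ψ.le_inv (ψ.inv_nonneg hx) (by rwa [ψ.apply_inv hx])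

theorem inv_pos {y : ℝ} (hy : 0 < y) : 0 < ψ.inv y := by
  refine (ψ.inv_nonneg hy.le).lt_of_ne fun h => ?_
  have := ψ.apply_inv hy.le
  rw [← h, ψ.map_zero] at this
  exact hy.ne this

theorem apply_mul_le {c x : ℝ} (hc : 0 ≤ c) (hc1 : c ≤ 1) (hx : 0 ≤ x) :
    ψ.toFun (c * x) ≤ c * ψ.toFun x := by
  have h := ψ.strictConvexOn.convexOn.2 (Set.mem_Ici.2 le_rfl) (Set.mem_Ici.2 hx)
    (sub_nonneg.2 hc1) hc (by ring)
  simpa [ψ.map_zero] using h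

/-- A form of the concavity of `ψ⁻¹`. It takes the constant of the growth estimate out of `ψ⁻¹`. -/
theorem inv_mul_le {c y : ℝ} (hc : 1 ≤ c) (hy : 0 ≤ y) : ψ.inv (c * y) ≤ c * ψ.inv y := by
  have hc0 : 0 < c := by linarith
  have hi := ψ.inv_nonneg hy
  refine ψ.inv_le (by positivity) (by positivity) ?_
  have h := ψ.apply_mul_le (_root_.inv_nonneg.2 hc0.le) (inv_le_one_of_one_le₀ hc)
    (mul_nonneg hc0.le hi)
  rw [inv_mul_cancel_left₀ hc0.ne', ψ.apply_inv hy, inv_mul_eq_div, le_div_iff₀' hc0] at h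
  exact h

/-- Superlinearity gives `ψ x ≥ x` for `x ≥ x₀`, hence `ψ (x₀ + y) ≥ y`. This at most linear growth
of `ψ⁻¹` makes the test functions vanish pointwise in the limit. -/
theorem exists_inv_le_add : ∃ x₀ : ℝ, 0 ≤ x₀ ∧ ∀ y, 0 ≤ y → ψ.inv y ≤ x₀ + y := by
  obtain ⟨x₀, h0, h⟩ := ((eventually_ge_atTop (1 : ℝ)).and
    (eventually_forall_ge_atTop.2 (tendsto_atTop.1 ψ.tendsto_div 1))).exists
  have h0' : (0 : ℝ) ≤ x₀ := zero_le_one.trans h0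
  refine ⟨x₀, h0', fun y hy => ψ.inv_le (by positivity) hy ?_⟩
  have h1 := h (x₀ + y) (by linarith)
  rw [le_div_iff₀ (by linarith), one_mul] at h1
  linarith

theorem tendsto_inv : Tendsto ψ.inv atTop atTop := by
  refine tendsto_atTop.2 fun b => ?_
  filter_upwards [eventually_ge_atTop (ψ.toFun (max b 0))] with y hy
  exact (le_max_left b 0).trans (ψ.le_inv (le_max_right _ _) hy)

end OrliczFunction

/-! ### Polar coordinates and complex linear changes of variables -/

/-- Polar coordinates for the Lebesgue integral. -/
theorem lintegral_polar {E : Type*} [NormedAddCommGroup E] [NormedSpace ℝ E] [MeasurableSpace E]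
    [BorelSpace E] [FiniteDimensional ℝ E] [Nontrivial E] (μ : Measure E) [μ.IsAddHaarMeasure]
    {F : E → ℝ≥0∞} (hF : Measurable F) :
    ∫⁻ x, F x ∂μ = ∫⁻ r in Set.Ioi (0 : ℝ), ENNReal.ofReal (r ^ (Module.finrank ℝ E - 1)) *
      ∫⁻ ζ : Metric.sphere (0 : E) 1, F (r • (ζ : E)) ∂μ.toSphere := by
  have hm : Measurable fun p : Metric.sphere (0 : E) 1 × Set.Ioi (0 : ℝ) =>
      F ((p.2 : ℝ) • (p.1 : E)) := by
    refine hF.comp ?_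
    exact (Continuous.smul (by fun_prop) (by fun_prop)).measurable
  have hm' : Measurable fun r : ℝ => ∫⁻ ζ : Metric.sphere (0 : E) 1, F (r • (ζ : E)) ∂μ.toSphere := by
    have h : Measurable fun p : ℝ × Metric.sphere (0 : E) 1 => F (p.1 • (p.2 : E)) :=
      hF.comp (Continuous.smul (by fun_prop) (by fun_prop)).measurable
    exact h.lintegral_prod_right'
  have key := μ.measurePreserving_homeomorphUnitSphereProd.lintegral_comp_emb
    (Homeomorph.measurableEmbedding _) fun p => F ((p.2 : ℝ) • (p.1 : E))
  have e : ∀ x : ({0}ᶜ : Set E), F ((((homeomorphUnitSphereProd E) x).2 : ℝ) •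
      (((homeomorphUnitSphereProd E) x).1 : E)) = F x := by
    intro x
    rw [← homeomorphUnitSphereProd_symm_apply_coe, Homeomorph.symm_apply_apply]
  simp only [e] at key
  rw [lintegral_subtype_comap (measurableSet_singleton _).compl, restrict_compl_singleton,
    lintegral_prod_symm _ hm.aemeasurable, Measure.volumeIoiPow] at key
  -- The spherical mean is displayed as a function on `ℝ` composed with the inclusion, so that its
  -- measurability applies when the density `r ^ (n - 1)` is extracted.
  change _ = ∫⁻ y, ((fun r : ℝ => ∫⁻ ζ : Metric.sphere (0 : E) 1, F (r • (ζ : E)) ∂μ.toSphere) ∘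
    (Subtype.val : Set.Ioi (0 : ℝ) → ℝ)) y ∂_ at key
  rw [lintegral_withDensity_eq_lintegral_mul _ (by fun_prop)
    (hm'.comp measurable_subtype_coe)] at key
  rw [key, ← lintegral_subtype_comap measurableSet_Ioi]
  rfl

variable {N : ℕ}

/-- A complex linear map, viewed over `ℝ`, has determinant `|det T| ^ 2`; translation invariance
removes `p`. -/
theorem lintegral_comp_add_linearMap {E : Type*} [NormedAddCommGroup E] [NormedSpace ℂ E]
    [NormedSpace ℝ E] [IsScalarTower ℝ ℂ E]
    [MeasurableSpace E] [BorelSpace E] [FiniteDimensional ℂ E] [FiniteDimensional ℝ E]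
    (μ : Measure E) [μ.IsAddHaarMeasure]
    (T : E →ₗ[ℂ] E) (hT : LinearMap.det T ≠ 0) (p : E) {F : E → ℝ≥0∞} (hF : Measurable F) :
    ∫⁻ w, F (p + T w) ∂μ = ENNReal.ofReal ((‖LinearMap.det T‖ ^ 2)⁻¹) * ∫⁻ x, F x ∂μ := by
  have hd : LinearMap.det (T.restrictScalars ℝ) = ‖LinearMap.det T‖ ^ 2 := by
    rw [LinearMap.det_restrictScalars, Algebra.norm_complex_apply, Complex.normSq_eq_norm_sq]
  have hd0 : LinearMap.det (T.restrictScalars ℝ) ≠ 0 := by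
    rw [hd]; exact pow_ne_zero _ (norm_ne_zero_iff.2 hT)
  have hmap := Measure.map_linearMap_addHaar_eq_smul_addHaar μ hd0
  have hTm : Measurable (T.restrictScalars ℝ) :=
    (LinearMap.continuous_of_finiteDimensional (T.restrictScalars ℝ)).measurable
  have h1 : ∫⁻ w, F (p + T w) ∂μ = ∫⁻ x, F (p + x) ∂(Measure.map (T.restrictScalars ℝ) μ) := by
    exact (lintegral_map (hF.comp (measurable_const_add p)) hTm).symm
  rw [h1, hmap, lintegral_smul_measure, lintegral_add_left_eq_self, hd, abs_of_nonneg (by positivity)]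
  rfl

/-- The linear map that multiplies by `s ^ 2` on the complex line spanned by the unit vector `e`
and by `s` on its orthogonal complement. -/
noncomputable def anisotropicMap (e : EuclideanSpace ℂ (Fin N)) (s : ℝ) :
    EuclideanSpace ℂ (Fin N) →ₗ[ℂ] EuclideanSpace ℂ (Fin N) :=
  (s : ℂ) • LinearMap.id + ((s : ℂ) ^ 2 - s) • (innerSL ℂ e).toLinearMap.smulRight e

theorem anisotropicMap_apply (e : EuclideanSpace ℂ (Fin N)) (s : ℝ) (w : EuclideanSpace ℂ (Fin N)) :
    anisotropicMap e s w = (s : ℂ) • w + (((s : ℂ) ^ 2 - s) * inner ℂ e w) • e := by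
  simp [anisotropicMap, mul_smul]

/-- In an orthonormal basis starting with `e` the map is diagonal, with one entry `s ^ 2` and `N -
1` entries `s`. -/
theorem det_anisotropicMap [NeZero N] {e : EuclideanSpace ℂ (Fin N)} (he : ‖e‖ = 1) (s : ℝ) :
    LinearMap.det (anisotropicMap e s) = (s : ℂ) ^ (N + 1) := by
  obtain ⟨b, hb⟩ := Orthonormal.exists_orthonormalBasis_extension_of_card_eq (𝕜 := ℂ)
    (E := EuclideanSpace ℂ (Fin N)) (ι := Fin N) (by simp) (v := fun _ => e) (s := {0}) (by
      constructor
      · intro i; simpa using he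
      · intro i j hij; exact absurd (Subsingleton.elim i j) hij)
  have hb0 : b 0 = e := hb 0 rfl
  rw [← LinearMap.det_toMatrix b.toBasis]
  have : LinearMap.toMatrix b.toBasis b.toBasis (anisotropicMap e s) =
      Matrix.diagonal fun i => if i = 0 then (s : ℂ) ^ 2 else s := by
    ext i j
    rw [LinearMap.toMatrix_apply, anisotropicMap_apply, ← hb0]
    simp only [OrthonormalBasis.coe_toBasis, OrthonormalBasis.coe_toBasis_repr_apply,
      OrthonormalBasis.repr_apply_apply, inner_add_right, inner_smul_right,
      OrthonormalBasis.inner_eq_ite, Matrix.diagonal_apply]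
    by_cases hij : i = j <;> by_cases hi : i = 0 <;> by_cases hj : j = 0 <;> simp_all
  rw [this, Matrix.det_diagonal, Finset.prod_ite]
  have hN : N - 1 + 1 = N := Nat.succ_pred_eq_of_ne_zero (NeZero.ne N)
  simp only [Finset.prod_const]
  have h1 : (Finset.univ.filter fun i : Fin N => i = 0).card = 1 := by
    rw [Finset.filter_eq']; simp
  have h2 : (Finset.univ.filter fun i : Fin N => ¬ i = 0).card = N - 1 := by
    rw [Finset.filter_not, Finset.card_sdiff_of_subset (Finset.filter_subset _ _), h1]; simp
  rw [h1, h2, pow_one, ← pow_add]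
  congr 1
  omega

theorem lintegral_anisotropicMap [NeZero N] {e : EuclideanSpace ℂ (Fin N)} (he : ‖e‖ = 1) {s : ℝ}
    (hs : 0 < s) (p : EuclideanSpace ℂ (Fin N))
    {F : EuclideanSpace ℂ (Fin N) → ℝ≥0∞} (hF : Measurable F) :
    ∫⁻ w, F (p + anisotropicMap e s w) =
      ENNReal.ofReal (((s ^ 2) ^ (N + 1))⁻¹) * ∫⁻ x, F x := by
  have hd := det_anisotropicMap he s
  rw [lintegral_comp_add_linearMap volume _ (by rw [hd]; exact_mod_cast (pow_pos hs _).ne') p hF,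
    hd]
  congr 3
  rw [norm_pow, Complex.norm_real, Real.norm_of_nonneg hs.le, ← pow_mul, ← pow_mul, mul_comm]

/-! ### Sub-mean value inequalities -/

namespace OrliczFunction

variable (ψ : OrliczFunction)

/-- Jensen's inequality combined with the mean value property on the unit circle. -/
theorem apply_norm_le_lintegral_circle {f : ℂ → ℂ}
    (hf : DifferentiableOn ℂ f (Metric.closedBall 0 1)) {K : ℝ} (hK : 0 < K) :
    ENNReal.ofReal (2 * Real.pi) * ENNReal.ofReal (ψ.toFun (‖f 0‖ / K)) ≤
      ∫⁻ θ in Set.Ioc 0 (2 * Real.pi), ENNReal.ofReal (ψ.toFun (‖f (circleMap 0 1 θ)‖ / K)) := by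
  have hpi : (0 : ℝ) < 2 * Real.pi := Real.two_pi_pos
  have hcirc : ∀ θ, circleMap 0 1 θ ∈ Metric.closedBall (0 : ℂ) 1 := fun θ => by simp
  have hc : Continuous fun θ => f (circleMap 0 1 θ) :=
    hf.continuousOn.comp_continuous (continuous_circleMap 0 1) hcirc
  have hcn : Continuous fun θ => ‖f (circleMap 0 1 θ)‖ / K := hc.norm.div_const K
  have hcψ : Continuous fun θ => ψ.toFun (‖f (circleMap 0 1 θ)‖ / K) :=
    ψ.continuousOn.comp_continuous hcn fun θ => Set.mem_Ici.2 (by positivity)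
  have hint : ∀ {g : ℝ → ℝ}, Continuous g →
      IntegrableOn g (Set.Ioc 0 (2 * Real.pi)) volume := fun hg =>
    (hg.continuousOn.integrableOn_Icc).mono_set Set.Ioc_subset_Icc_self
  have hmean : f 0 = (2 * Real.pi)⁻¹ • ∫ θ in (0)..(2 * Real.pi), f (circleMap 0 1 θ) := by
    rw [← Real.circleAverage_def]
    refine (DiffContOnCl.circleAverage ?_).symm
    rw [abs_one]
    exact (hf.mono (by rw [closure_ball _ one_ne_zero])).diffContOnCl
  have hvol : volume.real (Set.Ioc 0 (2 * Real.pi)) = 2 * Real.pi := by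
    rw [measureReal_def, Real.volume_Ioc, sub_zero, ENNReal.toReal_ofReal hpi.le]
  have hle : ‖f 0‖ / K ≤ ⨍ θ in Set.Ioc 0 (2 * Real.pi), ‖f (circleMap 0 1 θ)‖ / K := by
    rw [setAverage_eq, hvol, integral_div, smul_eq_mul, ← mul_div_assoc]
    gcongr
    rw [hmean, norm_smul, norm_inv, Real.norm_of_nonneg hpi.le,
      intervalIntegral.integral_of_le hpi.le]
    gcongr
    exact norm_integral_le_integral_norm _
  have hJ := ψ.strictConvexOn.convexOn.map_set_average_le ψ.continuousOn isClosed_Ici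
    (μ := volume) (t := Set.Ioc 0 (2 * Real.pi)) (f := fun θ => ‖f (circleMap 0 1 θ)‖ / K)
    (by simp [Real.pi_pos]) (by rw [Real.volume_Ioc]; exact ENNReal.ofReal_ne_top)
    (Eventually.of_forall fun θ => Set.mem_Ici.2 (by positivity))
    (hint hcn) (hint hcψ)
  have h1 := (ψ.le_of_le (by positivity) hle).trans hJ
  rw [setAverage_eq, hvol, smul_eq_mul, ← div_eq_inv_mul, le_div_iff₀' hpi] at h1
  rw [← ENNReal.ofReal_mul hpi.le, ← ofReal_integral_eq_lintegral_ofReal (hint hcψ)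
    (Eventually.of_forall fun θ => ψ.nonneg _ (by positivity))]
  exact ENNReal.ofReal_le_ofReal h1

/-- The sub-mean value property of `ψ (‖G‖ / K)` on a ball, for `G` holomorphic. -/
theorem apply_norm_le_lintegral_ball {N : ℕ} {G : EuclideanSpace ℂ (Fin N) → ℂ}
    (hG : DifferentiableOn ℂ G (Metric.ball 0 1)) {K : ℝ} (hK : 0 < K) :
    volume (Metric.ball (0 : EuclideanSpace ℂ (Fin N)) 1) *
        ENNReal.ofReal (ψ.toFun (‖G 0‖ / K)) ≤
      ∫⁻ w in Metric.ball 0 1, ENNReal.ofReal (ψ.toFun (‖G w‖ / K)) := by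
  set B := Metric.ball (0 : EuclideanSpace ℂ (Fin N)) 1 with hB
  have hBm : MeasurableSet B := measurableSet_ball
  -- Extension by zero gives a globally measurable function, and `ψ 0 = 0` makes `v` vanish off the
  -- ball, so rotation invariance can be used on the whole space.
  set G' := B.indicator G with hG'
  have hG'm : Measurable G' := by
    classical
    have := hG.continuousOn.measurable_piecewise (g := 0) continuousOn_const hBm
    rwa [Set.piecewise_eq_indicator] at this
  set v : EuclideanSpace ℂ (Fin N) → ℝ≥0∞ := fun w => ENNReal.ofReal (ψ.toFun (‖G' w‖ / K))
  have hv : Measurable v := ψ.measurable_comp_norm hG'm K hK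
  have hvB : v = B.indicator fun w => ENNReal.ofReal (ψ.toFun (‖G w‖ / K)) := by
    funext w
    by_cases hw : w ∈ B <;> simp [v, G', hw, ψ.map_zero]
  have hvint : ∫⁻ w in B, ENNReal.ofReal (ψ.toFun (‖G w‖ / K)) = ∫⁻ w, v w := by
    rw [hvB, lintegral_indicator hBm]
  have hrot : ∀ θ, ∫⁻ w, v (circleMap 0 1 θ • w) = ∫⁻ w, v w := by
    intro θ
    have hd : LinearMap.det (circleMap 0 1 θ • (LinearMap.id : EuclideanSpace ℂ (Fin N) →ₗ[ℂ] _))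
        = circleMap 0 1 θ ^ N := by
      rw [LinearMap.det_smul, LinearMap.det_id, mul_one]; simp
    have hn : ‖circleMap 0 1 θ‖ = 1 := by simp
    have h := lintegral_comp_add_linearMap volume
      (circleMap 0 1 θ • (LinearMap.id : EuclideanSpace ℂ (Fin N) →ₗ[ℂ] _))
      (by rw [hd, ← norm_ne_zero_iff, norm_pow, hn]; simp) 0 hv
    rw [hd, norm_pow, hn] at h
    simpa using h
  have hcirc : ∀ w ∈ B, ENNReal.ofReal (2 * Real.pi) * ENNReal.ofReal (ψ.toFun (‖G 0‖ / K)) ≤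
      ∫⁻ θ in Set.Ioc 0 (2 * Real.pi), v (circleMap 0 1 θ • w) := by
    intro w hw
    have hsub : Metric.closedBall 0 1 ⊆ (fun c : ℂ => c • w) ⁻¹' B := by
      intro c hc
      rw [mem_closedBall_zero_iff] at hc
      rw [hB, mem_ball_zero_iff] at hw
      rw [Set.mem_preimage, hB, mem_ball_zero_iff, norm_smul]
      nlinarith [norm_nonneg w]
    have h := ψ.apply_norm_le_lintegral_circle (f := fun c => G (c • w))
      (hG.comp (by fun_prop) hsub) hK
    simp only [zero_smul] at h
    refine h.trans (le_of_eq (lintegral_congr fun θ => ?_))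
    have : circleMap 0 1 θ • w ∈ B := hsub (by simp)
    simp [v, G', this]
  have hjoint : Measurable fun p : EuclideanSpace ℂ (Fin N) × ℝ => v (circleMap 0 1 p.2 • p.1) :=
    hv.comp (Continuous.smul ((continuous_circleMap 0 1).comp continuous_snd)
      continuous_fst).measurable
  -- The circle inequality on each complex line is integrated over `w`; after Tonelli every rotation
  -- contributes the same integral, and `2π` cancels.
  have h2 : ENNReal.ofReal (2 * Real.pi) * (volume B * ENNReal.ofReal (ψ.toFun (‖G 0‖ / K))) ≤
      ENNReal.ofReal (2 * Real.pi) * ∫⁻ w, v w := by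
    calc _ = ∫⁻ w in B, ENNReal.ofReal (2 * Real.pi) *
            ENNReal.ofReal (ψ.toFun (‖G 0‖ / K)) := by
          rw [setLIntegral_const]; ring
      _ ≤ ∫⁻ w in B, ∫⁻ θ in Set.Ioc 0 (2 * Real.pi), v (circleMap 0 1 θ • w) :=
          setLIntegral_mono' hBm hcirc
      _ ≤ ∫⁻ w, ∫⁻ θ in Set.Ioc 0 (2 * Real.pi), v (circleMap 0 1 θ • w) :=
          setLIntegral_le_lintegral _ _
      _ = ∫⁻ θ in Set.Ioc 0 (2 * Real.pi), ∫⁻ w, v (circleMap 0 1 θ • w) :=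
          lintegral_lintegral_swap hjoint.aemeasurable
      _ = _ := by
          simp only [hrot, lintegral_const, Measure.restrict_apply_univ, Real.volume_Ioc, sub_zero]
          rw [mul_comm]
  rw [hvint]
  exact (ENNReal.mul_le_mul_iff_right (by simp [Real.pi_pos]) ENNReal.ofReal_ne_top).1 h2

end OrliczFunction

/-! ### Geometry of the anisotropic ellipsoids -/

theorem exists_unit_eq_norm_smul [NeZero N] (z : EuclideanSpace ℂ (Fin N)) :
    ∃ e : EuclideanSpace ℂ (Fin N), ‖e‖ = 1 ∧ z = (‖z‖ : ℂ) • e := by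
  by_cases hz : z = 0
  · obtain ⟨e, he⟩ := exists_norm_eq (EuclideanSpace ℂ (Fin N)) zero_le_one
    exact ⟨e, he, by simp [hz]⟩
  · have hz' : ‖z‖ ≠ 0 := norm_ne_zero_iff.2 hz
    refine ⟨(‖z‖ : ℂ)⁻¹ • z, ?_, ?_⟩
    · rw [norm_smul, norm_inv, Complex.norm_real, norm_norm, inv_mul_cancel₀ hz']
    · rw [smul_inv_smul₀ (by exact_mod_cast hz')]

theorem norm_smul_add_sq {e v : EuclideanSpace ℂ (Fin N)} (he : ‖e‖ = 1)
    (hv : inner ℂ e v = 0) (c : ℂ) :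
    ‖c • e + v‖ ^ 2 = ‖c‖ ^ 2 + ‖v‖ ^ 2 := by
  rw [norm_add_sq (𝕜 := ℂ), inner_smul_left, hv, norm_smul, he]
  simp

theorem inner_sub_inner_smul {e : EuclideanSpace ℂ (Fin N)} (he : ‖e‖ = 1) (w : EuclideanSpace ℂ (Fin N)) :
    inner ℂ e (w - inner ℂ e w • e) = 0 := by
  rw [inner_sub_right, inner_smul_right, inner_self_eq_norm_sq_to_K, he]
  simp

theorem smul_add_anisotropicMap (e : EuclideanSpace ℂ (Fin N)) (s : ℝ) (c : ℂ)
    (w : EuclideanSpace ℂ (Fin N)) :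
    c • e + anisotropicMap e s w =
      (c + (s : ℂ) ^ 2 * inner ℂ e w) • e + (s : ℂ) • (w - inner ℂ e w • e) := by
  rw [anisotropicMap_apply]
  module

theorem norm_smul_add_anisotropicMap_sq {e : EuclideanSpace ℂ (Fin N)} (he : ‖e‖ = 1) (s : ℝ) (c : ℂ)
    (w : EuclideanSpace ℂ (Fin N)) :
    ‖c • e + anisotropicMap e s w‖ ^ 2 =
      ‖c + (s : ℂ) ^ 2 * inner ℂ e w‖ ^ 2 + s ^ 2 * ‖w - inner ℂ e w • e‖ ^ 2 := by
  rw [smul_add_anisotropicMap, norm_smul_add_sq he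
    (by rw [inner_smul_right, inner_sub_inner_smul he, mul_zero]), norm_smul, mul_pow,
    Complex.norm_real, Real.norm_eq_abs, sq_abs]

theorem norm_sq_eq_inner_add {e : EuclideanSpace ℂ (Fin N)} (he : ‖e‖ = 1) (w : EuclideanSpace ℂ (Fin N)) :
    ‖w‖ ^ 2 = ‖inner ℂ e w‖ ^ 2 + ‖w - inner ℂ e w • e‖ ^ 2 := by
  rw [← norm_smul_add_sq he (inner_sub_inner_smul he w), add_sub_cancel]

/-- The radial displacement is at most `d / 4`, and the orthogonal tangential one adds at most `d /
4` to the squared norm. The square of the norm is thus at most `(1 - 3d/4) ^ 2 + d / 4 < 1`, and the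
norm is at least `1 - 5d/4`. -/
theorem norm_smul_add_anisotropicMap_mem {e : EuclideanSpace ℂ (Fin N)} (he : ‖e‖ = 1)
    {d s : ℝ} (hd : 0 < d)
    (hd1 : d ≤ 1) (hs : s ^ 2 = d / 4) {w : EuclideanSpace ℂ (Fin N)} (hw : ‖w‖ < 1) :
    1 - 2 * d ≤ ‖((1 - d : ℝ) : ℂ) • e + anisotropicMap e s w‖ ∧
      ‖((1 - d : ℝ) : ℂ) • e + anisotropicMap e s w‖ < 1 := by
  have h := norm_smul_add_anisotropicMap_sq he s ((1 - d : ℝ) : ℂ) w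
  have hw2 := norm_sq_eq_inner_add he w
  set α := inner ℂ e w
  set x := ‖((1 - d : ℝ) : ℂ) • e + anisotropicMap e s w‖
  have hx : 0 ≤ x := norm_nonneg _
  have hα : ‖α‖ ≤ 1 := by nlinarith [norm_nonneg α, norm_nonneg w, sq_nonneg ‖w - α • e‖]
  have hv : ‖w - α • e‖ ^ 2 ≤ 1 := by nlinarith [norm_nonneg w, sq_nonneg ‖α‖]
  have hsc : (s : ℂ) ^ 2 = ((d / 4 : ℝ) : ℂ) := by rw [← hs]; push_cast; rfl
  have hsα : ‖(s : ℂ) ^ 2 * α‖ ≤ d / 4 := by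
    rw [norm_mul, hsc, Complex.norm_real, Real.norm_of_nonneg (by positivity)]
    nlinarith
  have hc : ‖((1 - d : ℝ) : ℂ)‖ = 1 - d := by
    rw [Complex.norm_real, Real.norm_of_nonneg (by linarith)]
  have hup := norm_add_le ((1 - d : ℝ) : ℂ) ((s : ℂ) ^ 2 * α)
  have hlo := norm_sub_le_norm_add ((1 - d : ℝ) : ℂ) ((s : ℂ) ^ 2 * α)
  rw [hc] at hup hlo
  set y := ‖((1 - d : ℝ) : ℂ) + (s : ℂ) ^ 2 * α‖
  have hy : 0 ≤ y := norm_nonneg _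
  rw [hs] at h
  constructor
  · have : y ≤ x := abs_le_of_sq_le_sq' (by nlinarith [sq_nonneg ‖w - α • e‖]) hx |>.2
    linarith
  · nlinarith

/-! ### Growth estimate and point evaluations -/

/-- Integration over a spherical shell whose spherical means are bounded. -/
theorem lintegral_shell_le {E : Type*} [NormedAddCommGroup E] [NormedSpace ℝ E] [MeasurableSpace E]
    [BorelSpace E] [FiniteDimensional ℝ E] [Nontrivial E] (μ : Measure E) [μ.IsAddHaarMeasure]
    {F : E → ℝ≥0∞} (hF : Measurable F) {t : ℝ}
    (hsupp : ∀ x, F x ≠ 0 → 1 - t ≤ ‖x‖ ∧ ‖x‖ < 1) {A : ℝ≥0∞}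
    (hA : ∀ r ∈ Set.Ioo (0 : ℝ) 1,
      ∫⁻ ζ : Metric.sphere (0 : E) 1, F (r • (ζ : E)) ∂μ.toSphere ≤ A) :
    ∫⁻ x, F x ∂μ ≤ ENNReal.ofReal t * A := by
  rw [lintegral_polar μ hF]
  have hpt : ∀ r ∈ Set.Ioi (0 : ℝ), ENNReal.ofReal (r ^ (Module.finrank ℝ E - 1)) *
      ∫⁻ ζ : Metric.sphere (0 : E) 1, F (r • (ζ : E)) ∂μ.toSphere ≤
      (Set.Ico (1 - t) 1).indicator (fun _ => A) r := by
    intro r hr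
    have hr0 : 0 < r := hr
    have hn : ∀ ζ : Metric.sphere (0 : E) 1, ‖r • (ζ : E)‖ = r := fun ζ => by
      rw [norm_smul, Real.norm_of_nonneg hr0.le, norm_eq_of_mem_sphere, mul_one]
    by_cases hr1 : r ∈ Set.Ico (1 - t) 1
    · rw [Set.indicator_of_mem hr1]
      calc _ ≤ 1 * A := mul_le_mul' (ENNReal.ofReal_le_one.2 (pow_le_one₀ hr0.le hr1.2.le))
            (hA r ⟨hr0, hr1.2⟩)
        _ = A := one_mul A
    · have : ∀ ζ : Metric.sphere (0 : E) 1, F (r • (ζ : E)) = 0 := fun ζ => by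
        by_contra hne
        have := hsupp _ hne
        rw [hn] at this
        exact hr1 this
      simp [this]
  calc _ ≤ ∫⁻ r in Set.Ioi (0 : ℝ), (Set.Ico (1 - t) 1).indicator (fun _ => A) r :=
        setLIntegral_mono' measurableSet_Ioi hpt
    _ ≤ ∫⁻ r, (Set.Ico (1 - t) 1).indicator (fun _ => A) r := setLIntegral_le_lintegral _ _
    _ = ENNReal.ofReal t * A := by
        rw [lintegral_indicator_const measurableSet_Ico, Real.volume_Ico, sub_sub_cancel, mul_comm]

theorem lintegral_sphereMeasure_le_iff {N : ℕ} [NeZero N] (F : UnitSphere N → ℝ≥0∞) (A : ℝ≥0∞) :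
    ∫⁻ ζ, F ζ ∂sphereMeasure N ≤ A ↔
      ∫⁻ ζ, F ζ ∂(volume : Measure (EuclideanSpace ℂ (Fin N))).toSphere ≤
        (volume : Measure (EuclideanSpace ℂ (Fin N))).toSphere Set.univ * A := by
  rw [sphereMeasure, lintegral_smul_measure, smul_eq_mul]
  refine ENNReal.inv_mul_le_iff ?_ (measure_ne_top _ _)
  rw [Measure.measure_univ_ne_zero]
  exact Measure.toSphere_ne_zero _

/-- The growth estimate for functions whose spherical means of `ψ (|f| / K)` are at most `1`. -/
theorem exists_apply_norm_le (N : ℕ) [NeZero N] :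
    ∃ C : ℝ, 1 ≤ C ∧ ∀ (ψ : OrliczFunction) (f : UnitBall N → ℂ) (_ : IsHolomorphic f) (K : ℝ)
      (_ : 0 < K)
      (_ : ∀ r, ∫⁻ ζ, ENNReal.ofReal (ψ.toFun (‖f (dilate r ζ)‖ / K)) ∂sphereMeasure N ≤ 1)
      (z : UnitBall N),
      ψ.toFun (‖f z‖ / K) ≤ C * (1 / (1 - ‖(z : EuclideanSpace ℂ (Fin N))‖) ^ N) := by
  set E := EuclideanSpace ℂ (Fin N)
  set n := Module.finrank ℝ E
  -- `4 ^ (N + 1)` is the inverse Jacobian for `s ^ 2 = d / 4` up to `d ^ (N + 1)`, `2` comes from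
  -- the shell thickness `2 * d`, and `n` from the total mass `n * volume B` of `toSphere`. The
  -- maximum with `1` serves `inv_mul_le`.
  refine ⟨max 1 (4 ^ (N + 1) * 2 * n), le_max_left _ _, fun ψ f hf K hK hS z => ?_⟩
  set B := Metric.ball (0 : E) 1 with hB
  obtain ⟨g, hg, hgf⟩ := hf
  obtain ⟨e, he, hze⟩ := exists_unit_eq_norm_smul (z : E)
  have hz1 : ‖(z : E)‖ < 1 := mem_ball_zero_iff.1 z.2
  set d := 1 - ‖(z : E)‖ with hd
  have hd0 : 0 < d := by linarith
  have hd1 : d ≤ 1 := by linarith [norm_nonneg (z : E)]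
  set s := √(d / 4)
  have hs0 : 0 < s := Real.sqrt_pos.2 (by positivity)
  have hs : s ^ 2 = d / 4 := Real.sq_sqrt (by positivity)
  have hze' : (z : E) = ((1 - d : ℝ) : ℂ) • e := by
    rw [hd, sub_sub_cancel]; exact hze
  have hmem : ∀ w ∈ B, 1 - 2 * d ≤ ‖(z : E) + anisotropicMap e s w‖ ∧
      ‖(z : E) + anisotropicMap e s w‖ < 1 := fun w hw => by
    rw [hze']
    exact norm_smul_add_anisotropicMap_mem he hd0 hd1 hs (mem_ball_zero_iff.1 hw)
  have hG : DifferentiableOn ℂ (fun w => g (z + anisotropicMap e s w)) B := by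
    refine hg.comp ?_ fun w hw => mem_ball_zero_iff.2 (hmem w hw).2
    exact ((LinearMap.toContinuousLinearMap (anisotropicMap e s)).differentiable.const_add
      (z : E)).differentiableOn
  have hsub := ψ.apply_norm_le_lintegral_ball hG hK
  simp only [map_zero, add_zero, hgf] at hsub
  have hg'm : Measurable (B.indicator g) := by
    classical
    have := hg.continuousOn.measurable_piecewise (g := 0) continuousOn_const
      (measurableSet_ball (x := (0 : E)) (ε := 1))
    rwa [Set.piecewise_eq_indicator] at this
  set S : Set E := {x | 1 - 2 * d ≤ ‖x‖ ∧ ‖x‖ < 1} with hSdef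
  have hSm : MeasurableSet S :=
    (measurableSet_le measurable_const measurable_norm).inter
      (measurableSet_lt measurable_norm measurable_const)
  set F : E → ℝ≥0∞ := S.indicator fun x => ENNReal.ofReal (ψ.toFun (‖B.indicator g x‖ / K))
  have hF : Measurable F := (ψ.measurable_comp_norm hg'm K hK).indicator hSm
  have h1 : ∫⁻ w in B, ENNReal.ofReal (ψ.toFun (‖g (z + anisotropicMap e s w)‖ / K)) ≤
      ∫⁻ w, F (z + anisotropicMap e s w) := by
    refine le_trans (setLIntegral_mono' measurableSet_ball fun w hw => ?_)
      (setLIntegral_le_lintegral B _)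
    have hm := hmem w hw
    have hmB : (z : E) + anisotropicMap e s w ∈ B := mem_ball_zero_iff.2 hm.2
    have hmS : (z : E) + anisotropicMap e s w ∈ S := hm
    simp [F, hmB, hmS]
  have h2 : ∫⁻ x, F x ≤ ENNReal.ofReal (2 * d) * (volume : Measure E).toSphere Set.univ := by
    refine lintegral_shell_le volume hF (fun x hx => ?_) fun r hr => ?_
    · by_contra hxS
      exact hx (Set.indicator_of_notMem (s := S) hxS _)
    · have h := (lintegral_sphereMeasure_le_iff _ _).1 (hS ⟨r, hr⟩)
      rw [mul_one] at h
      refine le_trans (lintegral_mono fun ζ => ?_) h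
      have hmB : r • (ζ : E) ∈ B := (dilate ⟨r, hr⟩ ζ).2
      refine (Set.indicator_le_self _ _ _).trans ?_
      rw [Set.indicator_of_mem hmB, ← hgf]
      rfl
  rw [lintegral_anisotropicMap he hs0 z hF, hs] at h1
  have h3 : volume B * ENNReal.ofReal (ψ.toFun (‖f z‖ / K)) ≤
      volume B * ENNReal.ofReal (4 ^ (N + 1) * 2 * n * (1 / d ^ N)) := by
    refine hsub.trans (h1.trans ?_)
    refine (mul_le_mul_right h2 _).trans (le_of_eq ?_)
    rw [Measure.toSphere_apply_univ, ← ENNReal.ofReal_natCast, ← mul_assoc, ← mul_assoc,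
      mul_comm (volume B), ← ENNReal.ofReal_mul (by positivity),
      ← ENNReal.ofReal_mul (by positivity)]
    congr 2
    rw [div_pow, pow_succ d]
    field_simp
    rfl
  have h4 := (ENNReal.mul_le_mul_iff_right (Metric.measure_ball_pos volume (0 : E) one_pos).ne'
    measure_ball_lt_top.ne).1 h3
  refine ((ENNReal.ofReal_le_ofReal_iff (by positivity)).1 h4).trans ?_
  gcongr
  exact le_max_right _ _

/-- Boundedness of point evaluations on the Hardy-Orlicz space. -/
theorem exists_norm_apply_le (N : ℕ) [NeZero N] :
    ∃ C : ℝ, 0 < C ∧ ∀ (ψ : OrliczFunction) (f : HardyOrlicz N ψ) (z : UnitBall N),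
      ‖f z‖ ≤ C * ψ.inv (1 / (1 - ‖(z : EuclideanSpace ℂ (Fin N))‖) ^ N) * ‖f‖ := by
  obtain ⟨C, hC1, hC⟩ := exists_apply_norm_le N
  refine ⟨C, by linarith, fun ψ f z => ?_⟩
  have hz1 : ‖(z : EuclideanSpace ℂ (Fin N))‖ < 1 := mem_ball_zero_iff.1 z.2
  set y := 1 / (1 - ‖(z : EuclideanSpace ℂ (Fin N))‖) ^ N
  have hy : 0 < y := by
    have : 0 < 1 - ‖(z : EuclideanSpace ℂ (Fin N))‖ := by linarith
    positivity
  have hi := ψ.inv_pos hy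
  -- The Luxemburg infimum yields the integral bound only for `K` strictly above the norm; `K` is
  -- then decreased to `‖f‖`, which also covers `‖f‖ = 0`.
  have key : ∀ K, ‖f‖ < K → ‖f z‖ ≤ C * ψ.inv y * K := by
    intro K hK
    have hK0 : 0 < K := (norm_nonneg f).trans_lt hK
    have h := hC ψ f f.isHolomorphic K hK0 (fun r => ψ.lintegral_le_one hK0 (lt_of_le_of_lt
      (le_iSup (fun r => ψ.luxemburgNorm (sphereMeasure N) fun ζ => f (dilate r ζ)) r)
      ((ENNReal.lt_ofReal_iff_toReal_lt f.norm_lt_top.ne).2 hK))) z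
    have h' := (ψ.le_inv (by positivity) h).trans (ψ.inv_mul_le hC1 hy.le)
    rwa [div_le_iff₀ hK0] at h'
  refine le_of_forall_pos_le_add fun ε hε => ?_
  have h := key (‖f‖ + ε / (C * ψ.inv y)) (by
    have : 0 < ε / (C * ψ.inv y) := by positivity
    linarith)
  rwa [mul_add, mul_div_cancel₀ _ (by positivity)] at h

/-! ### Spherical integrals of the kernel -/

theorem one_sub_norm_le_norm_one_sub_inner {a x : EuclideanSpace ℂ (Fin N)} (hx : ‖x‖ ≤ 1) :
    1 - ‖a‖ ≤ ‖1 - inner ℂ a x‖ := by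
  have h := norm_sub_norm_le (1 : ℂ) (inner ℂ a x)
  have h2 := norm_inner_le_norm (𝕜 := ℂ) a x
  rw [norm_one] at h
  nlinarith [norm_nonneg a]

theorem one_sub_norm_le_norm_one_sub_inner_of_left {a x : EuclideanSpace ℂ (Fin N)} (ha : ‖a‖ ≤ 1) :
    1 - ‖x‖ ≤ ‖1 - inner ℂ a x‖ := by
  have h := norm_sub_norm_le (1 : ℂ) (inner ℂ a x)
  have h2 := norm_inner_le_norm (𝕜 := ℂ) a x
  rw [norm_one] at h
  nlinarith [norm_nonneg x]

/-- Changing the radius alters the inner product by at most `|r - ρ| ≤ (1 - r) + (1 - |a|)`, and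
each summand is at most `|1 - ⟨rζ, a⟩|`. The kernel at any radius is thus dominated by its values
throughout a thin outer shell. -/
theorem norm_one_sub_inner_smul_le {a ζ : EuclideanSpace ℂ (Fin N)} (ha : ‖a‖ < 1) (hζ : ‖ζ‖ = 1)
    {r ρ : ℝ}
    (hr : r ∈ Set.Ioo (0 : ℝ) 1) (hρ : ρ ∈ Set.Ico (1 - (1 - ‖a‖) / 2) 1) :
    ‖1 - inner ℂ a (ρ • ζ)‖ ≤ 3 * ‖1 - inner ℂ a (r • ζ)‖ := by
  have hn : ‖r • ζ‖ = r := by rw [norm_smul, hζ, Real.norm_of_nonneg hr.1.le, mul_one]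
  have h1 : 1 - ‖a‖ ≤ ‖1 - inner ℂ a (r • ζ)‖ :=
    one_sub_norm_le_norm_one_sub_inner (hn.trans_le hr.2.le)
  have h2 : 1 - r ≤ ‖1 - inner ℂ a (r • ζ)‖ := by
    have := one_sub_norm_le_norm_one_sub_inner_of_left (x := r • ζ) ha.le
    rwa [hn] at this
  have e : 1 - inner ℂ a (ρ • ζ) = (1 - inner ℂ a (r • ζ)) + inner ℂ a ((r - ρ) • ζ) := by
    rw [sub_smul, inner_sub_right]; ring
  have h3 : ‖inner ℂ a ((r - ρ) • ζ)‖ ≤ |r - ρ| := by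
    refine (norm_inner_le_norm _ _).trans ?_
    rw [norm_smul, hζ, mul_one, Real.norm_eq_abs]
    nlinarith [abs_nonneg (r - ρ)]
  have h4 : |r - ρ| ≤ (1 - r) + (1 - ‖a‖) := by
    rw [abs_le]; constructor <;> linarith [hr.2, hρ.1, hρ.2]
  rw [e]
  linarith [norm_add_le (1 - inner ℂ a (r • ζ)) (inner ℂ a ((r - ρ) • ζ))]

/-- Let `α` and `v` be the components of `w` along and orthogonal to `e`, `x = 1 + δα`, `q = |1 -
tx|`. Then `δ ≤ q` and `1 - |x| ≤ q`. The identity `δα = -(1 - tx) + δx` gives `δ|α| ≤ 2q`, and `|x|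
^ 2 + δ|v| ^ 2 < 1` gives `δ|v| ^ 2 ≤ 2q`. As `|v| ≤ (1 + |v| ^ 2) / 2`, these add up to less than
`5q`. -/
theorem mul_one_add_norm_le {e : EuclideanSpace ℂ (Fin N)} (he : ‖e‖ = 1) {t s : ℝ}
    (ht : 0 ≤ t) (ht1 : t < 1)
    (hs : s ^ 2 = 1 - t) {w : EuclideanSpace ℂ (Fin N)} (hw : ‖e + anisotropicMap e s w‖ < 1) :
    (1 - t) * (1 + ‖w‖) ≤ 5 * ‖1 - inner ℂ ((t : ℂ) • e) (e + anisotropicMap e s w)‖ := by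
  have h := norm_smul_add_anisotropicMap_sq he s 1 w
  have hx := smul_add_anisotropicMap e s 1 w
  rw [one_smul] at h hx
  have hw2 := norm_sq_eq_inner_add he w
  set α := inner ℂ e w
  set δ := 1 - t with hδ
  have hsc : (s : ℂ) ^ 2 = (δ : ℂ) := by rw [← hs]; push_cast; rfl
  have hin : inner ℂ ((t : ℂ) • e) (e + anisotropicMap e s w) = t * (1 + δ * α) := by
    rw [hx, inner_smul_left, inner_add_right, inner_smul_right, inner_smul_right,
      inner_sub_inner_smul he, inner_self_eq_norm_sq_to_K, he, hsc]
    simp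
  rw [hin]
  rw [hsc, hs] at h
  set x := 1 + (δ : ℂ) * α with hxdef
  set q := ‖1 - (t : ℂ) * x‖
  have hx1 : ‖x‖ < 1 := by
    by_contra hcon
    have : 0 ≤ δ * ‖w - α • e‖ ^ 2 := by positivity
    nlinarith [norm_nonneg (e + anisotropicMap e s w)]
  have hδ0 : 0 < δ := by linarith
  have hq0 : 1 - t * ‖x‖ ≤ q := by
    have := norm_sub_norm_le (1 : ℂ) (t * x)
    rwa [norm_one, norm_mul, Complex.norm_real, Real.norm_of_nonneg ht] at this
  have hq1 : δ ≤ q := by nlinarith [norm_nonneg x]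
  have hq2 : 1 - ‖x‖ ≤ q := by nlinarith [norm_nonneg x]
  have hq3 : δ * ‖α‖ ≤ 2 * q := by
    have e1 : (δ : ℂ) * α = -(1 - t * x) + δ * x := by
      have hδc : (δ : ℂ) = 1 - t := by rw [hδ]; push_cast; rfl
      linear_combination -hxdef - x * hδc
    have e2 := norm_add_le (-(1 - (t : ℂ) * x)) (δ * x)
    rw [← e1, norm_neg, norm_mul, norm_mul, Complex.norm_real, Real.norm_of_nonneg hδ0.le] at e2
    nlinarith
  have hq4 : δ * ‖w - α • e‖ ^ 2 ≤ 2 * q := by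
    have : ‖e + anisotropicMap e s w‖ ^ 2 < 1 := by
      nlinarith [norm_nonneg (e + anisotropicMap e s w)]
    nlinarith [norm_nonneg x]
  have hwle : ‖w‖ ≤ ‖α‖ + ‖w - α • e‖ := by
    refine abs_le_of_sq_le_sq' ?_ (by positivity) |>.2
    nlinarith [mul_nonneg (norm_nonneg α) (norm_nonneg (w - α • e))]
  have hv : 2 * ‖w - α • e‖ ≤ 1 + ‖w - α • e‖ ^ 2 := by
    nlinarith [sq_nonneg (‖w - α • e‖ - 1)]
  nlinarith

/-- The power kernel has integral of order `(1 - |a|) ^ N` over the spheres. -/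
theorem exists_lintegral_kernel_le (N : ℕ) [NeZero N] :
    ∃ C : ℝ, 1 ≤ C ∧ ∀ a : EuclideanSpace ℂ (Fin N), ‖a‖ < 1 → ∀ r ∈ Set.Ioo (0 : ℝ) 1,
      ∫⁻ ζ : UnitSphere N, ENNReal.ofReal (((1 - ‖a‖) /
        ‖1 - inner ℂ a (r • (ζ : EuclideanSpace ℂ (Fin N)))‖) ^ (2 * N + 1)) ∂sphereMeasure N ≤
      ENNReal.ofReal (C * (1 - ‖a‖) ^ N) := by
  set E := EuclideanSpace ℂ (Fin N)
  set n := Module.finrank ℝ E with hn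
  have hnN : n = 2 * N := by
    rw [hn, finrank_real_of_complex]; simp [E]
  set m := 2 * N + 1
  set κ := (volume : Measure E).toSphere Set.univ
  have hκ0 : κ ≠ 0 := by
    rw [Measure.measure_univ_ne_zero]
    exact Measure.toSphere_ne_zero _
  have hκT : κ ≠ ∞ := measure_ne_top _ _
  -- Finite because the exponent `2N + 1` exceeds the real dimension `2N`.
  set J := ∫⁻ w : E, ENNReal.ofReal ((1 + ‖w‖) ^ (-(m : ℝ)))
  have hJ : J ≠ ∞ := (finite_integral_one_add_norm (by
    change (n : ℝ) < m
    rw [hnN]; push_cast [m]; linarith)).ne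
  -- `3 ^ m` pays for the change of radius, `5 ^ m` for the kernel bound after rescaling, and `2 ^
  -- (n + 1)` (with a factor `2` to spare) for the thickness `δ / 2` and for `ρ ^ (n - 1)` with `ρ ≥
  -- 1 / 2`.
  set D : ℝ≥0∞ := κ⁻¹ * (ENNReal.ofReal (3 ^ m * 5 ^ m * 2 ^ (n + 1)) * J) with hD
  have hDT : D ≠ ∞ := ENNReal.mul_ne_top (ENNReal.inv_ne_top.2 hκ0)
    (ENNReal.mul_ne_top ENNReal.ofReal_ne_top hJ)
  refine ⟨max 1 D.toReal, le_max_left _ _, fun a ha r hr => ?_⟩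
  set δ := 1 - ‖a‖ with hδ
  have hδ0 : 0 < δ := by linarith
  have hδ1 : δ ≤ 1 := by linarith [norm_nonneg a]
  set H : E → ℝ≥0∞ := fun x => ENNReal.ofReal ((δ / ‖1 - inner ℂ a x‖) ^ m) with hH
  have hHm : Measurable H := by
    have : Measurable fun x : E => inner ℂ a x := by fun_prop
    fun_prop
  set B := Metric.ball (0 : E) 1
  set F : E → ℝ≥0∞ := B.indicator H
  have hF : Measurable F := hHm.indicator measurableSet_ball
  obtain ⟨I, hIdef⟩ : ∃ I, I = ∫⁻ ζ : Metric.sphere (0 : E) 1, H (r • (ζ : E)) ∂volume.toSphere :=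
    ⟨_, rfl⟩
  have hcomp : ∀ ρ ∈ Set.Ico (1 - δ / 2) 1, I ≤ ENNReal.ofReal (3 ^ m) *
      ∫⁻ ζ : Metric.sphere (0 : E) 1, F (ρ • (ζ : E)) ∂volume.toSphere := by
    intro ρ hρ
    have hρ0 : 0 < ρ := by linarith [hρ.1]
    rw [hIdef, ← lintegral_const_mul' _ _ ENNReal.ofReal_ne_top]
    refine lintegral_mono fun ζ => ?_
    have hζ : ‖(ζ : E)‖ = 1 := norm_eq_of_mem_sphere ζ
    have hB : ρ • (ζ : E) ∈ B := by
      rw [mem_ball_zero_iff, norm_smul, hζ, Real.norm_of_nonneg hρ0.le, mul_one]; exact hρ.2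
    have hle := norm_one_sub_inner_smul_le ha hζ hr hρ
    have hpos : 0 < ‖1 - inner ℂ a (ρ • (ζ : E))‖ :=
      hδ0.trans_le (one_sub_norm_le_norm_one_sub_inner (mem_ball_zero_iff.1 hB).le)
    simp only [F, Set.indicator_of_mem hB, hH]
    rw [← ENNReal.ofReal_mul (by positivity), ← mul_pow]
    refine ENNReal.ofReal_le_ofReal (pow_le_pow_left₀ (by positivity) ?_ _)
    rw [← mul_div_assoc, div_le_div_iff₀ (by linarith) hpos]
    nlinarith
  -- Averaging over the shell turns the integral over one sphere into a volume integral, at the cost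
  -- of a factor `1 / δ`.
  have hpolar : ENNReal.ofReal (δ / 2 * (1 / 2) ^ (n - 1)) * I ≤
      ENNReal.ofReal (3 ^ m) * ∫⁻ x, F x := by
    rw [lintegral_polar volume hF, ← lintegral_const_mul' _ _ ENNReal.ofReal_ne_top]
    calc _ = ∫⁻ ρ in Set.Ico (1 - δ / 2) 1, ENNReal.ofReal ((1 / 2) ^ (n - 1)) * I := by
          rw [setLIntegral_const, Real.volume_Ico, sub_sub_cancel,
            ENNReal.ofReal_mul (by positivity)]
          ring
      _ ≤ ∫⁻ ρ in Set.Ico (1 - δ / 2) 1, ENNReal.ofReal (3 ^ m) * (ENNReal.ofReal (ρ ^ (n - 1)) *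
            ∫⁻ ζ : Metric.sphere (0 : E) 1, F (ρ • (ζ : E)) ∂volume.toSphere) := by
          refine setLIntegral_mono' measurableSet_Ico fun ρ hρ => ?_
          rw [mul_left_comm]
          refine mul_le_mul' (ENNReal.ofReal_le_ofReal ?_) (hcomp ρ hρ)
          exact pow_le_pow_left₀ (by norm_num) (by linarith [hρ.1]) _
      _ ≤ _ := lintegral_mono_set fun ρ hρ => Set.mem_Ioi.2 (by linarith [hρ.1])
  obtain ⟨e, he, hae⟩ := exists_unit_eq_norm_smul a
  have hs0 : 0 < √δ := Real.sqrt_pos.2 hδ0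
  have hs : √δ ^ 2 = 1 - ‖a‖ := Real.sq_sqrt hδ0.le
  -- With `x = e + anisotropicMap e (√δ) w` the kernel is at most `(5 / (1 + |w|)) ^ m`. The
  -- Jacobian `δ ^ (N + 1)` absorbs the lost `1 / δ` and leaves `δ ^ N`.
  have hvol : ENNReal.ofReal ((δ ^ (N + 1))⁻¹) * ∫⁻ x, F x ≤ ENNReal.ofReal (5 ^ m) * J := by
    have h := lintegral_anisotropicMap he hs0 e hF
    rw [hs] at h
    rw [← h, ← lintegral_const_mul' _ _ ENNReal.ofReal_ne_top]
    refine lintegral_mono fun w => ?_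
    by_cases hw : e + anisotropicMap e (√δ) w ∈ B
    · have hle := mul_one_add_norm_le he (norm_nonneg a) ha hs (mem_ball_zero_iff.1 hw)
      rw [← hae, ← hδ] at hle
      have hpos : 0 < ‖1 - inner ℂ a (e + anisotropicMap e (√δ) w)‖ :=
        hδ0.trans_le (one_sub_norm_le_norm_one_sub_inner (mem_ball_zero_iff.1 hw).le)
      simp only [F, Set.indicator_of_mem hw, hH]
      rw [← ENNReal.ofReal_mul (by positivity), Real.rpow_neg (by positivity), Real.rpow_natCast,
        ← inv_pow, ← mul_pow]
      refine ENNReal.ofReal_le_ofReal (pow_le_pow_left₀ (by positivity) ?_ _)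
      rw [← div_eq_mul_inv, div_le_div_iff₀ hpos (by positivity)]
      exact hle
    · simp [F, hw]
  have hI : I ≤ ENNReal.ofReal (δ ^ N) *
      (ENNReal.ofReal (3 ^ m * 5 ^ m * 2 ^ (n + 1)) * J) := by
    have hn1 : n - 1 + 1 = n := Nat.succ_pred_eq_of_ne_zero (by
      rw [hnN]; exact mul_ne_zero two_ne_zero (NeZero.ne N))
    have hc : 0 < δ / 2 * (1 / 2) ^ (n - 1) := by positivity
    rw [← ENNReal.mul_le_mul_iff_right (ENNReal.ofReal_pos.2 hc).ne' ENNReal.ofReal_ne_top]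
    have hFle : ∫⁻ x, F x ≤ ENNReal.ofReal (δ ^ (N + 1)) * (ENNReal.ofReal (5 ^ m) * J) := by
      rw [ENNReal.ofReal_inv_of_pos (by positivity)] at hvol
      exact (ENNReal.inv_mul_le_iff (ENNReal.ofReal_pos.2 (by positivity)).ne'
        ENNReal.ofReal_ne_top).1 hvol
    refine hpolar.trans ((mul_le_mul_right hFle _).trans ?_)
    rw [← mul_assoc, ← mul_assoc, ← mul_assoc, ← mul_assoc, ← ENNReal.ofReal_mul (by positivity),
      ← ENNReal.ofReal_mul (by positivity), ← ENNReal.ofReal_mul (by positivity),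
      ← ENNReal.ofReal_mul (by positivity)]
    refine mul_le_mul_left (ENNReal.ofReal_le_ofReal ?_) _
    have e2 : (1 / 2 : ℝ) ^ (n - 1) * 2 ^ (n + 1) = 4 := by
      rw [show n + 1 = (n - 1) + 2 by omega, pow_add, ← mul_assoc, ← mul_pow]; norm_num
    have e3 : δ / 2 * (1 / 2) ^ (n - 1) * δ ^ N * (3 ^ m * 5 ^ m * 2 ^ (n + 1)) =
        2 * (3 ^ m * δ ^ (N + 1) * 5 ^ m) := by
      rw [pow_succ δ]
      linear_combination (δ / 2 * δ ^ N * 3 ^ m * 5 ^ m) * e2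
    rw [e3]
    have : 0 ≤ 3 ^ m * δ ^ (N + 1) * 5 ^ m := by positivity
    linarith
  refine (lintegral_sphereMeasure_le_iff _ _).2 (hIdef.symm.trans_le (hI.trans ?_))
  have hDle : D ≤ ENNReal.ofReal (max 1 D.toReal) := by
    rw [← ENNReal.ofReal_toReal hDT, ENNReal.toReal_ofReal ENNReal.toReal_nonneg]
    exact ENNReal.ofReal_le_ofReal (le_max_right _ _)
  have hκD : κ * D = ENNReal.ofReal (3 ^ m * 5 ^ m * 2 ^ (n + 1)) * J := by
    rw [hD, ← mul_assoc, ENNReal.mul_inv_cancel hκ0 hκT, one_mul]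
  calc _ = κ * (D * ENNReal.ofReal (δ ^ N)) := by
        rw [mul_comm (ENNReal.ofReal (δ ^ N)), ← hκD, mul_assoc]
    _ ≤ _ := by
        rw [ENNReal.ofReal_mul (by positivity)]
        gcongr

/-! ### Test functions: norm bound and pointwise decay -/

/-- The test functions `ψ⁻¹(1 / (1 - |a|) ^ N) ((1 - |a|) / (1 - ⟨z, a⟩)) ^ (2 N + 1)` are bounded in
the Hardy-Orlicz space. -/
theorem exists_testFunction (N : ℕ) [NeZero N] :
    ∃ C : ℝ, ∀ (ψ : OrliczFunction) (a : UnitBall N), ∃ f : HardyOrlicz N ψ, ‖f‖ ≤ C ∧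
      ∀ z : UnitBall N, f z = (ψ.inv (1 / (1 - ‖(a : EuclideanSpace ℂ (Fin N))‖) ^ N) : ℂ) *
        (((1 - ‖(a : EuclideanSpace ℂ (Fin N))‖ : ℝ) : ℂ) /
          (1 - inner ℂ (a : EuclideanSpace ℂ (Fin N)) z)) ^ (2 * N + 1) := by
  obtain ⟨C, hC1, hC⟩ := exists_lintegral_kernel_le N
  refine ⟨C, fun ψ a => ?_⟩
  have hC0 : 0 < C := by linarith
  have ha : ‖(a : EuclideanSpace ℂ (Fin N))‖ < 1 := mem_ball_zero_iff.1 a.2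
  set δ := 1 - ‖(a : EuclideanSpace ℂ (Fin N))‖ with hδ
  have hδ0 : 0 < δ := by linarith
  set M := ψ.inv (1 / δ ^ N)
  have hM : 0 < M := ψ.inv_pos (by positivity)
  set g : EuclideanSpace ℂ (Fin N) → ℂ := fun z =>
    (M : ℂ) * ((δ : ℂ) / (1 - inner ℂ (a : EuclideanSpace ℂ (Fin N)) z)) ^ (2 * N + 1)
  have hlow : ∀ z : EuclideanSpace ℂ (Fin N), ‖z‖ < 1 →
      δ ≤ ‖1 - inner ℂ (a : EuclideanSpace ℂ (Fin N)) z‖ := fun z hz =>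
    one_sub_norm_le_norm_one_sub_inner hz.le
  have hgd : DifferentiableOn ℂ g (Metric.ball 0 1) := by
    intro z hz
    have h1 : DifferentiableAt ℂ
        (fun z : EuclideanSpace ℂ (Fin N) => inner ℂ (a : EuclideanSpace ℂ (Fin N)) z) z :=
      (innerSL ℂ (a : EuclideanSpace ℂ (Fin N))).differentiableAt
    have h2 : 1 - inner ℂ (a : EuclideanSpace ℂ (Fin N)) z ≠ 0 :=
      norm_pos_iff.1 (hδ0.trans_le (hlow z (mem_ball_zero_iff.1 hz)))
    have h3 := h1.const_sub 1
    have h4 : DifferentiableAt ℂ (fun z : EuclideanSpace ℂ (Fin N) =>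
        (δ : ℂ) / (1 - inner ℂ (a : EuclideanSpace ℂ (Fin N)) z)) z :=
      by simpa only [div_eq_mul_inv] using (h3.fun_inv h2).const_mul (δ : ℂ)
    exact ((h4.fun_pow _).const_mul _).differentiableWithinAt
  have hnorm : hardyOrliczNorm ψ (fun z : UnitBall N => g z) ≤ ENNReal.ofReal C := by
    refine iSup_le fun r => ψ.luxemburgNorm_le hC0 ?_
    have hpt : ∀ ζ : UnitSphere N, ENNReal.ofReal (ψ.toFun (‖g (dilate r ζ)‖ / C)) ≤
        ENNReal.ofReal (C⁻¹ * (1 / δ ^ N)) * ENNReal.ofReal ((δ /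
          ‖1 - inner ℂ (a : EuclideanSpace ℂ (Fin N))
            ((r : ℝ) • (ζ : EuclideanSpace ℂ (Fin N)))‖) ^ (2 * N + 1)) := by
      intro ζ
      have hl := hlow _ (mem_ball_zero_iff.1 (dilate r ζ).2)
      change δ ≤ ‖1 - inner ℂ (a : EuclideanSpace ℂ (Fin N))
            ((r : ℝ) • (ζ : EuclideanSpace ℂ (Fin N)))‖ at hl
      have hgn : ‖g (dilate r ζ)‖ = M * (δ / ‖1 - inner ℂ (a : EuclideanSpace ℂ (Fin N))
            ((r : ℝ) • (ζ : EuclideanSpace ℂ (Fin N)))‖) ^ (2 * N + 1) := by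
        simp only [g, norm_mul, norm_pow, norm_div, Complex.norm_real,
          Real.norm_of_nonneg hM.le, Real.norm_of_nonneg hδ0.le]
        rfl
      rw [hgn]
      set t := (δ / ‖1 - inner ℂ (a : EuclideanSpace ℂ (Fin N))
            ((r : ℝ) • (ζ : EuclideanSpace ℂ (Fin N)))‖) ^ (2 * N + 1)
      have ht0 : 0 ≤ t := by positivity
      have ht1 : t ≤ 1 := pow_le_one₀ (by positivity) (div_le_one_of_le₀ hl (norm_nonneg _))
      rw [← ENNReal.ofReal_mul (by positivity)]
      refine ENNReal.ofReal_le_ofReal ?_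
      -- Since `t / C ≤ 1`, convexity makes `ψ` linear in the kernel: `ψ (tM / C) ≤ (t / C) ψ M = t
      -- / (C δ ^ N)`.
      have h := ψ.apply_mul_le (c := t / C) (by positivity)
        (div_le_one_of_le₀ (ht1.trans hC1) hC0.le) hM.le
      rw [ψ.apply_inv (by positivity)] at h
      calc _ = ψ.toFun (t / C * M) := by congr 1; ring
        _ ≤ _ := h
        _ = _ := by ring
    refine (lintegral_mono hpt).trans ?_
    rw [lintegral_const_mul' _ _ ENNReal.ofReal_ne_top]
    refine (mul_le_mul_right (hC a ha r r.2) _).trans ?_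
    rw [← ENNReal.ofReal_mul (by positivity), ← hδ]
    refine le_of_eq ?_
    rw [show C⁻¹ * (1 / δ ^ N) * (C * δ ^ N) = 1 by field_simp, ENNReal.ofReal_one]
  refine ⟨⟨fun z => g z, ⟨g, hgd, fun _ => rfl⟩, hnorm.trans_lt ENNReal.ofReal_lt_top⟩, ?_,
    fun z => rfl⟩
  exact ENNReal.toReal_le_of_le_ofReal hC0.le hnorm

theorem OrliczFunction.tendsto_inv_one_div {N : ℕ} (hN : N ≠ 0) (ψ : OrliczFunction)
    {ι : Type*} {l : Filter ι} {ρ : ι → ℝ} (hρ : ∀ i, ρ i < 1) (h : Tendsto ρ l (𝓝 1)) :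
    Tendsto (fun i => ψ.inv (1 / (1 - ρ i) ^ N)) l atTop := by
  refine ψ.tendsto_inv.comp ?_
  simp only [one_div]
  refine tendsto_inv_nhdsGT_zero.comp (tendsto_nhdsWithin_iff.2 ⟨?_, ?_⟩)
  · have := (h.const_sub 1).pow N
    rwa [sub_self, zero_pow hN] at this
  · exact Eventually.of_forall fun i => Set.mem_Ioi.2 (pow_pos (sub_pos.2 (hρ i)) _)

/-- At fixed `x` the kernel is `O(δ ^ (2N + 1))` with `δ = 1 - |a_k|`, whereas `ψ⁻¹(1 / δ ^ N) ≤ x₀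
+ δ ^ (-N)`; the product is `O(δ)`. -/
theorem tendsto_testFunction_zero {N : ℕ} [NeZero N] (ψ : OrliczFunction)
    {a : ℕ → UnitBall N} (ha : Tendsto (fun k => ‖(a k : EuclideanSpace ℂ (Fin N))‖) atTop (𝓝 1))
    (x : UnitBall N) :
    Tendsto (fun k => (ψ.inv (1 / (1 - ‖(a k : EuclideanSpace ℂ (Fin N))‖) ^ N) : ℂ) *
        (((1 - ‖(a k : EuclideanSpace ℂ (Fin N))‖ : ℝ) : ℂ) /
          (1 - inner ℂ (a k : EuclideanSpace ℂ (Fin N)) x)) ^ (2 * N + 1)) atTop (𝓝 0) := by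
  obtain ⟨x₀, hx₀, hinv⟩ := ψ.exists_inv_le_add
  have hx : ‖(x : EuclideanSpace ℂ (Fin N))‖ < 1 := mem_ball_zero_iff.1 x.2
  have hx' : 0 < 1 - ‖(x : EuclideanSpace ℂ (Fin N))‖ := by linarith
  have hlim : Tendsto (fun k => (x₀ + 1) * (1 - ‖(a k : EuclideanSpace ℂ (Fin N))‖) /
      (1 - ‖(x : EuclideanSpace ℂ (Fin N))‖) ^ (2 * N + 1)) atTop (𝓝 0) := by
    have := ((ha.const_sub 1).const_mul (x₀ + 1)).div_const
      ((1 - ‖(x : EuclideanSpace ℂ (Fin N))‖) ^ (2 * N + 1))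
    simpa using this
  refine squeeze_zero_norm (fun k => ?_) hlim
  have hak : ‖(a k : EuclideanSpace ℂ (Fin N))‖ < 1 := mem_ball_zero_iff.1 (a k).2
  have hak0 := norm_nonneg (a k : EuclideanSpace ℂ (Fin N))
  set δ := 1 - ‖(a k : EuclideanSpace ℂ (Fin N))‖
  have hδ0 : 0 < δ := by simp only [δ]; linarith
  have hδ1 : δ ≤ 1 := by simp only [δ]; linarith
  have hy : (0 : ℝ) ≤ 1 / δ ^ N := by positivity
  have hM := ψ.inv_nonneg hy
  rw [norm_mul, norm_pow, norm_div, Complex.norm_real, Complex.norm_real, Real.norm_of_nonneg hM,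
    Real.norm_of_nonneg hδ0.le, div_pow, ← mul_div_assoc]
  refine div_le_div₀ (by positivity) ?_ (by positivity)
    (pow_le_pow_left₀ hx'.le (one_sub_norm_le_norm_one_sub_inner_of_left hak.le) _)
  calc _ ≤ (x₀ + 1 / δ ^ N) * δ ^ (2 * N + 1) := by gcongr; exact hinv _ hy
    _ = x₀ * δ ^ (2 * N + 1) + δ ^ (N + 1) := by
        rw [add_mul, show 2 * N + 1 = N + (N + 1) by ring, pow_add δ N (N + 1)]
        field_simp
    _ ≤ x₀ * δ + δ := by
        gcongr
        · exact pow_le_of_le_one hδ0.le hδ1 (by omega)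
        · exact pow_le_of_le_one hδ0.le hδ1 (by omega)
    _ = _ := by ring

end HardyOrliczBall

/-! ### Compactness forces the ratio to vanish -/

theorem proposition3p14 {N : ℕ} [NeZero N] (ψ : HardyOrliczBall.OrliczFunction)
    (ϕ : HardyOrliczBall.UnitBall N → HardyOrliczBall.UnitBall N)
    (hϕ : HardyOrliczBall.IsHolomorphic fun z => (ϕ z : EuclideanSpace ℂ (Fin N)))
    (hc : HardyOrliczBall.IsCompactCompositionOperator ψ ϕ) :
    Tendsto
      (fun z : HardyOrliczBall.UnitBall N =>
        ψ.inv (1 / (1 - ‖(ϕ z : EuclideanSpace ℂ (Fin N))‖) ^ N) /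
          ψ.inv (1 / (1 - ‖(z : EuclideanSpace ℂ (Fin N))‖) ^ N))
      (comap (fun z : HardyOrliczBall.UnitBall N => ‖(z : EuclideanSpace ℂ (Fin N))‖) (𝓝 1))
      (𝓝 0) := by
  obtain ⟨T, hT, hTc⟩ := hc
  obtain ⟨Ct, hCt⟩ := HardyOrliczBall.exists_testFunction N
  obtain ⟨Ce, hCe0, hCe⟩ := HardyOrliczBall.exists_norm_apply_le N
  choose f hf hfz using fun a => hCt ψ a
  have hlt : ∀ x : HardyOrliczBall.UnitBall N, ‖(x : EuclideanSpace ℂ (Fin N))‖ < 1 :=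
    fun x => mem_ball_zero_iff.1 x.2
  have hpos : ∀ x : HardyOrliczBall.UnitBall N,
      0 < ψ.inv (1 / (1 - ‖(x : EuclideanSpace ℂ (Fin N))‖) ^ N) := fun x =>
    ψ.inv_pos (one_div_pos.2 (pow_pos (sub_pos.2 (hlt x)) _))
  refine tendsto_of_subseq_tendsto fun z hz => ?_
  have hz1 : Tendsto (fun k => ‖(z k : EuclideanSpace ℂ (Fin N))‖) atTop (𝓝 1) :=
    (tendsto_comap (f := fun w : HardyOrliczBall.UnitBall N =>
      ‖(w : EuclideanSpace ℂ (Fin N))‖)).comp hz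
  have hcomp := hTc.isCompact_closure_image_of_bounded
    (Metric.isBounded_closedBall (x := (0 : HardyOrliczBall.HardyOrlicz N ψ)) (r := Ct))
  obtain ⟨h, -, i, hi, hTi⟩ := hcomp.tendsto_subseq (x := fun k => T (f (ϕ (z k)))) fun k =>
    subset_closure ⟨_, mem_closedBall_zero_iff.2 (hf _), rfl⟩
  obtain ⟨ℓ, hℓ, j, hj, hℓj⟩ := (isCompact_Icc (a := (0 : ℝ)) (b := 1)).tendsto_subseq
    (x := fun k => ‖(ϕ (z (i k)) : EuclideanSpace ℂ (Fin N))‖) fun k =>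
    ⟨norm_nonneg _, (hlt _).le⟩
  refine ⟨i ∘ j, ?_⟩
  have hij : Tendsto (i ∘ j) atTop atTop := hi.tendsto_atTop.comp hj.tendsto_atTop
  have hden := ψ.tendsto_inv_one_div (NeZero.ne N) (fun k => hlt (z ((i ∘ j) k)))
    (hz1.comp hij)
  -- Either `|ϕ(z)|` stays below some `c < 1` along the subsequence and the numerator is bounded, or
  -- it tends to `1` and compactness is needed.
  rcases hℓ.2.lt_or_eq with hℓ1 | rfl
  · obtain ⟨c, hℓc, hc1⟩ := exists_between hℓ1
    refine squeeze_zero' (Eventually.of_forall fun k => (div_pos (hpos _) (hpos _)).le) ?_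
      (hden.const_div_atTop (ψ.inv (1 / (1 - c) ^ N)))
    filter_upwards [hℓj.eventually_lt_const hℓc] with k hk
    refine div_le_div_of_nonneg_right ?_ (hpos _).le
    have h1 : 0 < 1 - ‖(ϕ (z (i (j k))) : EuclideanSpace ℂ (Fin N))‖ := sub_pos.2 (hlt _)
    refine ψ.inv_mono (by positivity) ?_
    refine one_div_le_one_div_of_le (pow_pos (by linarith) _) (pow_le_pow_left₀ (by linarith) ?_ _)
    exact sub_le_sub_left (le_of_lt hk) 1
  · have hTij : Tendsto (fun k => ‖T (f (ϕ (z ((i ∘ j) k)))) - h‖) atTop (𝓝 0) :=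
      tendsto_iff_norm_sub_tendsto_zero.1 (hTi.comp hj.tendsto_atTop)
    -- Norm convergence implies pointwise convergence, and the values `f_a(ϕ w)` tend to `0` as `|a|
    -- → 1`.
    have h0 : h = 0 := by
      refine DFunLike.ext _ _ fun w => ?_
      have e1 : Tendsto (fun k => f (ϕ (z ((i ∘ j) k))) (ϕ w)) atTop (𝓝 (h w)) := by
        rw [tendsto_iff_norm_sub_tendsto_zero]
        have hlim := hTij.const_mul (Ce * ψ.inv (1 / (1 - ‖(w : EuclideanSpace ℂ (Fin N))‖) ^ N))
        rw [mul_zero] at hlim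
        refine squeeze_zero (fun _ => norm_nonneg _) (fun k => ?_) hlim
        rw [← hT]
        exact hCe ψ (T (f (ϕ (z ((i ∘ j) k)))) - h) w
      have e2 := HardyOrliczBall.tendsto_testFunction_zero ψ
        (a := fun k => ϕ (z ((i ∘ j) k))) hℓj (ϕ w)
      simp only [← hfz] at e2
      exact tendsto_nhds_unique e1 e2
    rw [h0] at hTij
    simp only [sub_zero] at hTij
    have hlim := hTij.const_mul (2 ^ (2 * N + 1) * Ce)
    rw [mul_zero] at hlim
    refine squeeze_zero (fun k => (div_pos (hpos _) (hpos _)).le) (fun k => ?_) hlim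
    rw [div_le_iff₀ (hpos _)]
    set p := z ((i ∘ j) k)
    have hev := hCe ψ (T (f (ϕ p))) p
    rw [hT, hfz, inner_self_eq_norm_sq_to_K] at hev
    have ha := hlt (ϕ p)
    have ha0 := norm_nonneg (ϕ p : EuclideanSpace ℂ (Fin N))
    have hM := hpos (ϕ p)
    set b := ‖(ϕ p : EuclideanSpace ℂ (Fin N))‖
    -- At `z = a` the kernel is `(1 - b) / (1 - b ^ 2) = 1 / (1 + b) ≥ 1 / 2`, whence the factor `2
    -- ^ (2N + 1)`.
    have e3 : (((1 - b : ℝ) : ℂ) / (1 - (RCLike.ofReal b : ℂ) ^ 2)) = (((1 + b)⁻¹ : ℝ) : ℂ) := by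
      have h1 : (1 : ℝ) - b ≠ 0 := by linarith
      have h2 : (1 : ℝ) + b ≠ 0 := by linarith
      have : (1 - (RCLike.ofReal b : ℂ) ^ 2) = ((1 - b ^ 2 : ℝ) : ℂ) := by push_cast; rfl
      rw [this, ← Complex.ofReal_div]
      congr 1
      rw [show 1 - b ^ 2 = (1 - b) * (1 + b) by ring]
      field_simp
    rw [e3, norm_mul, norm_pow, Complex.norm_real, Complex.norm_real, Real.norm_of_nonneg hM.le,
      Real.norm_of_nonneg (by positivity), inv_pow, ← div_eq_mul_inv,
      div_le_iff₀ (by positivity)] at hev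
    refine hev.trans ?_
    have hpow : (1 + b) ^ (2 * N + 1) ≤ 2 ^ (2 * N + 1) :=
      pow_le_pow_left₀ (by positivity) (by linarith) _
    have hD := hpos p
    calc _ ≤ Ce * ψ.inv (1 / (1 - ‖(p : EuclideanSpace ℂ (Fin N))‖) ^ N) * ‖T (f (ϕ p))‖ *
          2 ^ (2 * N + 1) := by gcongr
      _ = _ := by ring
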